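/- Let $G$ be a locally compact Hausdorff group with left Haar measure $|\cdot|$, modular function $\triangle$ (normalised by $|Ut|=|U|\triangle(t)$), convolution $*$ on $L_1(G)$, and $L_\infty(G)=L_1(G)^*$. Put $l_tf(x)=f(t^{-1}x)$, $R_tf(x)=f(xt^{-1})\triangle(t^{-1})$, $f^\dagger(x)=f(x^{-1})\triangle(x^{-1})$, and $\mathcal P_1(G)=\{f\in L_1(G): f\ge 0,\ \|f\|_1=1\}$. For $T\in L_\infty(G)$ and $f\in L_1(G)$ define $fT,Tf\in L_\infty(G)$ by $\langle fT,g\rangle=\langle T,f*g\rangle$ and $\langle Tf,g\rangle=\langle T,g*f\rangle$ for $g\in L_1(G)$. A mean is a positive unital functional $m$ on $L_\infty(G)$; it belongs to $\mathrm{TLIM}(G)$ if $\langle m,fT\rangle=\langle m,T\rangle$ for all $f\in\mathcal P_1(G)$, $T\in L_\infty(G)$, to $\mathrm{TRIM}(G)$ if $\langle m,Tf\rangle=\langle m,T\rangle$ for all such $f,T$, and $\mathrm{TIM}(G)=\mathrm{TLIM}(G)\cap\mathrm{TRIM}(G)$. Let $\mathcal K$ be a family of compact subsets of $G$ that is closed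 under finite unions and whose interiors cover $G$. Let $\Gamma=\mathcal K\times\{1,2,3,\dots\}$, directed by $(K,m)\preceq(J,n)$ iff $K\subseteq J$ and $m\le n$, and let $\Gamma^*$ be the set of ultrafilters on $\Gamma$ that contain every tail $\{\gamma:\gamma\succ\alpha\}$, $\alpha\in\Gamma$. For each $\gamma=(K,n)\in\Gamma$ let $F_\gamma\subseteq G$ be a compact set of positive measure such that $\lambda_\gamma=1_{F_\gamma}/|F_\gamma|$ satisfies $\|l_x\lambda_\gamma-\lambda_\gamma\|_1<\frac1n$ for all $x\in K$ (such sets exist when $G$ is amenable), and let $\rho_\gamma=\lambda_\gamma^\dagger$. Regard $L_1(G)$ as a subset of $L_\infty(G)^*$ with its weak-* topology, in which all limits and closures are taken. Then for every $p\in\Gamma^*$: 1. the closed convex hull of $\{p\text{-}\lim_\gamma R_{t_\gamma}\lambda_\gamma : (t_\gamma)\in G^\Gamma\}$ equals $\mathrm{TLIM}(G)$; 2. the closed convex hull of $\{p\text{-}\lim_\gamma l_{t_\gamma}\rho_\gamma : (t_\gamma)\in G^\Gamma\}$ equals $\mathrm{TRIM}(G)$; 3. the closed convex hull of $\{p\text{-}\lim_\gamma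 \lambda_\gamma*(l_{t_\gamma}\rho_\gamma) : (t_\gamma)\in G^\Gamma\}$ equals $\mathrm{TIM}(G)$. -/

import Mathlib

open MeasureTheory TopologicalSpace Filter Topology
open scoped ENNReal NNReal ComplexOrder

noncomputable section

namespace TopInvMean

section Basic

variable {G : Type*} [Group G] [TopologicalSpace G] [IsTopologicalGroup G]
  [LocallyCompactSpace G] [MeasurableSpace G] [BorelSpace G]

/-- `L₁(G)`, with respect to the left Haar measure `μ`. -/
abbrev L1 (μ : Measure G) := Lp ℂ 1 μ

/-- `L_∞(G)`. The Haar measure `μ` is always taken inner regular below, so that the null sets are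
exactly the locally null sets and `L_∞(G)` is the dual of `L₁(G)` also when `G` is not
`σ`-compact. -/
abbrev Linf (μ : Measure G) := Lp ℂ ∞ μ

/-- The modular function `△`, normalised by `|U t| = |U| △(t)`.
(Mathlib's `modularCharacter g` is the factor by which the measure `A ↦ |A g⁻¹|` differs from
Haar measure.) -/
def modular (t : G) : ℝ := (Measure.modularCharacter t⁻¹ : ℝ≥0)

/-- The normalisation of `△`: `|U t| = |U| △(t)`. -/
theorem measure_mul_right (μ : Measure G) [μ.IsHaarMeasure] [μ.InnerRegular] (U : Set G) (t : G) :
    μ ((fun x => x * t) '' U) = μ U * ENNReal.ofReal (modular t) := by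
  have h := Measure.map_right_mul_eq_modularCharacterFun_smul μ t⁻¹
  have h1 : (fun x => x * t) '' U = (fun x => x * t⁻¹) ⁻¹' U := by
    ext x
    simp only [Set.mem_image, Set.mem_preimage]
    exact ⟨by rintro ⟨y, hy, rfl⟩; simpa using hy, fun hx => ⟨_, hx, by simp⟩⟩
  have h2 : Measure.map (fun x => x * t⁻¹) μ U = μ ((fun x => x * t⁻¹) ⁻¹' U) :=
    (MeasurableEquiv.mulRight t⁻¹).map_apply U
  rw [h1, ← h2, h, Measure.smul_apply, mul_comm]
  change _ = ENNReal.ofReal ((Measure.modularCharacterFun t⁻¹ : ℝ≥0) : ℝ) * _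
  rw [ENNReal.ofReal_coe_nnreal]
  rfl

theorem continuous_modular : Continuous (modular : G → ℝ) := by
  let μ : Measure G := Measure.haar
  obtain ⟨⟨g, g_cont⟩, g_comp, g_nonneg, g_one⟩ :
    ∃ g : C(G, ℝ), HasCompactSupport g ∧ 0 ≤ g ∧ g 1 ≠ 0 := exists_continuous_nonneg_pos 1
  have hpos : 0 < ∫ x, g x ∂μ :=
    g_cont.integral_pos_of_hasCompactSupport_nonneg_nonzero g_comp g_nonneg g_one
  have key (t : G) : (Measure.modularCharacter t : ℝ≥0) = (∫ x, g (x * t) ∂μ) / ∫ x, g x ∂μ := by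
    have h := Measure.modularCharacterFun_eq_haarScalarFactor μ t
    change ((Measure.modularCharacterFun t : ℝ≥0) : ℝ) = _
    rw [h, Measure.haarScalarFactor_eq_integral_div _ _ g_cont g_comp hpos.ne',
      integral_map (by fun_prop) g_cont.aestronglyMeasurable]
  have hc : Continuous fun t : G => ∫ x, g (x * t) ∂μ := by
    have := MeasureTheory.continuous_integral_apply_inv_mul (μ := μ.inv) g_cont g_comp
    refine this.congr fun t => ?_
    rw [Measure.inv_def, integral_map (by fun_prop)]
    · simp
    · exact (by fun_prop : Continuous fun y : G => g (y⁻¹ * t)).aestronglyMeasurable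
  have : (modular : G → ℝ) = fun t => (∫ x, g (x * t⁻¹) ∂μ) / ∫ x, g x ∂μ := by
    ext t; exact key t⁻¹
  rw [this]
  exact (hc.comp continuous_inv).div_const _

variable (μ : Measure G)

/-- Left translation on `L₁(G)`: `l_t f (x) = f (t⁻¹ x)`. -/
def leftTranslate [μ.IsHaarMeasure] (t : G) (f : L1 μ) : L1 μ :=
  Lp.compMeasurePreserving (fun x => t⁻¹ * x) (measurePreserving_mul_left μ t⁻¹) f

theorem memLp_rightTranslate [μ.IsHaarMeasure] [μ.InnerRegular] (t : G) (f : L1 μ) :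
    MemLp (fun x => f (x * t⁻¹) * (modular t⁻¹ : ℂ)) 1 μ := by
  have h := Measure.map_right_mul_eq_modularCharacterFun_smul μ t⁻¹
  have h1 : MemLp (f : G → ℂ) 1 (Measure.map (fun x => x * t⁻¹) μ) := by
    rw [h]
    exact (Lp.memLp f).smul_measure (c := (Measure.modularCharacterFun t⁻¹ : ℝ≥0∞))
      ENNReal.coe_ne_top
  exact (h1.comp_of_map (by fun_prop)).mul_const _

/-- Normalised right translation on `L₁(G)`: `R_t f (x) = f (x t⁻¹) △(t⁻¹)`. -/
def rightTranslate [μ.IsHaarMeasure] [μ.InnerRegular] (t : G) (f : L1 μ) : L1 μ :=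
  (memLp_rightTranslate μ t f).toLp _

/-- The convolution of `L₁(G)`: `(f * g)(x) = ∫ f(t) g(t⁻¹ x) dt`, that is, the `L₁(G)`-valued
integral `∫ f(t) l_t g dt`. -/
def conv [μ.IsHaarMeasure] (f g : L1 μ) : L1 μ :=
  ∫ t, f t • leftTranslate μ t g ∂μ

/-- The integral that defines the convolution converges for all `f, g ∈ L₁(G)`. -/
theorem integrable_conv [μ.IsHaarMeasure] [μ.InnerRegular] (f g : L1 μ) :
    Integrable (fun t => f t • leftTranslate μ t g) μ := by
  have hcont : Continuous fun t : G => leftTranslate μ t g := by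
    have : Fact ((1 : ℝ≥0∞) ≠ ∞) := ⟨ENNReal.one_ne_top⟩
    have h : Continuous fun t : G => DomMulAct.mk t⁻¹ • g :=
      (DomMulAct.continuous_mk.comp continuous_inv).smul continuous_const
    exact h
  have hS (S : Set G) (hS : MeasurableSet S) (hfin : μ S ≠ ∞) :
      AEStronglyMeasurable (fun t => leftTranslate μ t g) (μ.restrict S) := by
    have hK (n : ℕ) := hS.exists_isCompact_isClosed_sdiff_lt hfin (ε := (n + 1 : ℝ≥0∞)⁻¹) (by simp)
    choose K hKS hKc hKcl hKm using hK
    have hae : (⋃ n, K n : Set G) =ᵐ[μ] S := by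
      refine (Set.iUnion_subset hKS).eventuallyLE.antisymm (ae_le_set.2 ?_)
      refine le_antisymm (ENNReal.le_of_forall_pos_le_add fun ε hε _ => ?_) bot_le
      obtain ⟨n, hn⟩ := ENNReal.exists_inv_nat_lt (ENNReal.coe_pos.2 hε).ne'
      rw [zero_add]
      calc μ (S \ ⋃ n, K n) ≤ μ (S \ K n) :=
            measure_mono (Set.sdiff_subset_sdiff_right (Set.subset_iUnion K n))
        _ ≤ (n + 1 : ℝ≥0∞)⁻¹ := (hKm n).le
        _ ≤ (n : ℝ≥0∞)⁻¹ := ENNReal.inv_le_inv.2 le_self_add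
        _ ≤ ε := hn.le
    rw [← Measure.restrict_congr_set hae, aestronglyMeasurable_iUnion_iff]
    intro n
    exact hcont.continuousOn.aestronglyMeasurable_of_isCompact (hKc n) (hKcl n).measurableSet
  obtain ⟨f', hf', hff'⟩ := (memLp_one_iff_integrable.1 (Lp.memLp f)).aefinStronglyMeasurable
  obtain ⟨s, hs, hlim⟩ := hf'
  have hmeas : AEStronglyMeasurable (fun t => f t • leftTranslate μ t g) μ := by
    have h' : AEStronglyMeasurable (fun t => f' t • leftTranslate μ t g) μ := by
      refine aestronglyMeasurable_of_tendsto_ae atTop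
        (f := fun n t => s n t • leftTranslate μ t g) (fun n => ?_)
        (Eventually.of_forall fun t => (hlim t).smul_const _)
      have hsupp : MeasurableSet (Function.support (s n)) := (s n).measurableSet_support
      have h1 : (fun t => s n t • leftTranslate μ t g) = (Function.support (s n)).indicator
          (fun t => s n t • leftTranslate μ t g) := by
        refine (Set.indicator_eq_self.2 fun t ht => ?_).symm
        intro h0
        exact ht (by simp [h0])
      rw [h1, aestronglyMeasurable_indicator_iff hsupp]
      exact (s n).stronglyMeasurable.aestronglyMeasurable.smul (hS _ hsupp (hs n).ne)
    refine h'.congr ?_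
    filter_upwards [hff'] with t ht
    rw [ht]
  refine ((L1.integrable_coeFn f).norm.mul_const ‖g‖).mono' hmeas (Eventually.of_forall fun t => ?_)
  rw [norm_smul]
  exact le_of_eq (congrArg _ (Lp.norm_compMeasurePreserving g _))

/-- The duality between `L₁(G)` and `L_∞(G)`: `f ∈ L₁(G)` is the functional
`T ↦ ⟨f, T⟩ = ∫ f T` in `L_∞(G)^*`; the latter carries the weak-* topology. -/
def toDual (f : L1 μ) : WeakDual ℂ (Linf μ) :=
  StrongDual.toWeakDual ((ContinuousLinearMap.mul ℂ ℂ).lpPairing μ 1 ∞ f)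

set_option linter.unusedSectionVars false in
theorem toDual_apply (f : L1 μ) (T : Linf μ) : toDual μ f T = ∫ x, f x * T x ∂μ :=
  (ContinuousLinearMap.mul ℂ ℂ).lpPairing_eq_integral f T

/-- `𝒫₁(G) = {f ∈ L₁(G) : f ≥ 0, ‖f‖₁ = 1}`. -/
def P1 : Set (L1 μ) := {f | (∀ᵐ x ∂μ, 0 ≤ f x) ∧ ‖f‖ = 1}

/-- The constant function `1` in `L_∞(G)`. -/
def one : Linf μ := (memLp_top_const (1 : ℂ)).toLp (fun _ : G => (1 : ℂ))

/-- The means (states) on `L_∞(G)`: the positive unital functionals. -/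
def means : Set (WeakDual ℂ (Linf μ)) :=
  {m | (∀ T : Linf μ, (∀ᵐ x ∂μ, 0 ≤ T x) → 0 ≤ m T) ∧ m (one μ) = 1}

variable [μ.IsHaarMeasure]

/-- `S = fT`, where `fT ∈ L_∞(G)` is defined by `⟨fT, g⟩ = ⟨T, f * g⟩` for `g ∈ L₁(G)`. -/
def IsLeftAct (f : L1 μ) (T S : Linf μ) : Prop :=
  ∀ g : L1 μ, toDual μ g S = toDual μ (conv μ f g) T

/-- `S = Tf`, where `Tf ∈ L_∞(G)` is defined by `⟨Tf, g⟩ = ⟨T, g * f⟩` for `g ∈ L₁(G)`. -/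
def IsRightAct (f : L1 μ) (T S : Linf μ) : Prop :=
  ∀ g : L1 μ, toDual μ g S = toDual μ (conv μ g f) T

/-- The topologically left invariant means on `L_∞(G)`: `⟨m, fT⟩ = ⟨m, T⟩`. -/
def TLIM : Set (WeakDual ℂ (Linf μ)) :=
  {m | m ∈ means μ ∧ ∀ f ∈ P1 μ, ∀ T S : Linf μ, IsLeftAct μ f T S → m S = m T}

/-- The topologically right invariant means on `L_∞(G)`: `⟨m, Tf⟩ = ⟨m, T⟩`. -/
def TRIM : Set (WeakDual ℂ (Linf μ)) :=
  {m | m ∈ means μ ∧ ∀ f ∈ P1 μ, ∀ T S : Linf μ, IsRightAct μ f T S → m S = m T}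

/-- The topologically two-sided invariant means on `L_∞(G)`. -/
def TIM : Set (WeakDual ℂ (Linf μ)) := TLIM μ ∩ TRIM μ

/-- The normalised indicator function `1_F / |F|`. -/
def lam [T2Space G] (F : Compacts G) : L1 μ :=
  indicatorConstLp 1 F.isCompact.measurableSet F.isCompact.measure_ne_top (((μ F).toReal : ℂ)⁻¹)

/-- A compact set `F` of positive measure is `(K, ε)`-left-invariant if its normalised indicator
function `1_F / |F|` is moved by less than `ε` in `L₁(G)` by each `l_x`, `x ∈ K`. -/
def IsLeftInvariant [T2Space G] (K : Set G) (ε : ℝ) (F : Compacts G) : Prop :=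
  0 < μ F ∧ ∀ x ∈ K, ‖leftTranslate μ x (lam μ F) - lam μ F‖ < ε

/-- `f† (x) = f(x⁻¹) △(x⁻¹)`. -/
def dagger (f : G → ℂ) (x : G) : ℂ := f x⁻¹ * (modular x⁻¹ : ℂ)

theorem memLp_dagger [T2Space G] (F : Compacts G) :
    MemLp (dagger ((F : Set G).indicator fun _ => ((μ F).toReal : ℂ)⁻¹)) 1 μ := by
  have hc : IsCompact ((F : Set G)⁻¹) := F.isCompact.inv
  have h : dagger ((F : Set G).indicator fun _ => ((μ F).toReal : ℂ)⁻¹) =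
      ((F : Set G)⁻¹).indicator fun x => ((μ F).toReal : ℂ)⁻¹ * (modular x⁻¹ : ℂ) := by
    ext x
    by_cases hx : x⁻¹ ∈ (F : Set G)
    · simp [dagger, Set.indicator, hx]
    · simp [dagger, Set.indicator, hx]
  rw [h, memLp_one_iff_integrable, integrable_indicator_iff hc.measurableSet]
  refine ContinuousOn.integrableOn_compact hc (Continuous.continuousOn ?_)
  exact continuous_const.mul (Complex.continuous_ofReal.comp (continuous_modular.comp continuous_inv))

/-- `(1_F / |F|)†`. -/
def rho [T2Space G] (F : Compacts G) : L1 μ := (memLp_dagger μ F).toLp _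

end Basic

/-- `Γ^*`: the ultrafilters on the directed set `Γ` that contain every tail `{γ : γ > α}`. -/
def tailUltrafilters (Γ : Type*) [Preorder Γ] : Set (Ultrafilter Γ) :=
  {p | ∀ α : Γ, Set.Ioi α ∈ p}

/-- The set of all ultrafilter limits `p-lim_γ x (γ, t_γ)` in the space `X`, over all choices
`(t_γ) ∈ A^Γ`. -/
def limitSet {Γ A X : Type*} [TopologicalSpace X] (p : Ultrafilter Γ) (x : Γ → A → X) : Set X :=
  {m | ∃ t : Γ → A, Tendsto (fun γ => x γ (t γ)) p (𝓝 m)}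

end TopInvMean

end

open MeasureTheory TopologicalSpace Filter Topology
open scoped ENNReal NNReal ComplexOrder

noncomputable section

namespace TopInvMean

set_option linter.unusedSectionVars false

/-! ### Modular function, inversion and the involution `f ↦ f†` -/

section Modular

variable {G : Type*} [Group G] [TopologicalSpace G] [IsTopologicalGroup G]
  [LocallyCompactSpace G] [MeasurableSpace G] [BorelSpace G]

/-! Each limit set lies in the set of invariant means because the densities are asymptotically
invariant. Since `R_t` commutes with `l_s`, every `R_t λ_γ` is moved by `l_s` exactly as much as
`λ_γ` is, uniformly in `t`. Hence `f * R_t λ_γ - R_t λ_γ` tends to `0` in norm, uniformly in `t`,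
for each `f ∈ 𝒫₁(G)`, and weak-* limits are topologically left invariant
(`eq_of_tendsto_of_asymptotically_invariant`). The involution `†` gives the right-handed case. In
`λ_γ * l_t ρ_γ` the left factor carries left invariance and the right factor right invariance.

Conversely, a mean `m` outside the closed convex hull is separated from it by some `T ∈ L_∞(G)` and
`u`: `Re < u` on the hull and `Re m(T) > u`. As `f * g = ∫ g(t) R_t f dt`, the element `λ_γ T` is
the function `t ↦ ⟨R_t λ_γ, T⟩` (`isLeftAct_orbitCoefficient`). If its real part were at most `u`
everywhere, then `Re m(T) = Re m(λ_γ T) ≤ u`. So each `γ` admits `t_γ` with `Re ⟨R_{t_γ} λ_γ, T⟩ >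
u`, and by Banach–Alaoglu the `p`-limit exists and violates the separation
(`mem_closure_convexHull_limitSet`). For two-sided means the same argument is applied to `(λ_γ T)
ρ_γ`.

As `G` need not be `σ`-compact, Fubini is applied only to compactly supported continuous integrands,
and identities in `L₁(G)` follow by density. -/

theorem modular_pos (t : G) : 0 < modular t :=
  NNReal.coe_pos.2 (Measure.modularCharacterFun_pos t⁻¹)

theorem modular_mul (s t : G) : modular (s * t) = modular s * modular t := by
  simp only [modular, mul_inv_rev, map_mul, NNReal.coe_mul, mul_comm]

theorem modular_inv_mul_self (t : G) : modular t⁻¹ * modular t = 1 := by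
  rw [← modular_mul, inv_mul_cancel, modular, inv_one, map_one, NNReal.coe_one]

theorem modular_inv (t : G) : modular t⁻¹ = (modular t)⁻¹ :=
  eq_inv_of_mul_eq_one_left (modular_inv_mul_self t)

variable [T2Space G] (μ : Measure G) [μ.IsHaarMeasure] [μ.InnerRegular]

theorem integral_mul_right_eq {E : Type*} [NormedAddCommGroup E] [NormedSpace ℝ E] (g : G → E)
    (t : G) : ∫ x, g (x * t) ∂μ = modular t⁻¹ • ∫ x, g x ∂μ := by
  have h := Measure.map_right_mul_eq_modularCharacterFun_smul μ t
  have h1 := (MeasurableEquiv.mulRight t).measurableEmbedding.integral_map (μ := μ) g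
  simp only [MeasurableEquiv.coe_mulRight] at h1
  rw [← h1, h, integral_smul_nnreal_measure, modular, inv_inv]
  rfl

/-- Follows from the formula comparing the left Haar measure `μ` with the right Haar measure `μ.inv`
through an auxiliary `g`: the inner integral of `g` is a right translate, so it equals a value of
`△` times `∫ g`, and `∫ g` cancels. -/
theorem integral_comp_inv_mul_modular (f : G → ℝ) (hf : Continuous f) (hfc : HasCompactSupport f) :
    ∫ x, f x⁻¹ * modular x⁻¹ ∂μ = ∫ x, f x ∂μ := by
  obtain ⟨⟨g, g_cont⟩, g_comp, g_nonneg, g_one⟩ :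
    ∃ g : C(G, ℝ), HasCompactSupport g ∧ 0 ≤ g ∧ g 1 ≠ 0 := exists_continuous_nonneg_pos 1
  have hpos : 0 < ∫ x, g x ∂μ :=
    g_cont.integral_pos_of_hasCompactSupport_nonneg_nonzero g_comp g_nonneg g_one
  have hinv (u : G → ℝ) : ∫ x, u x ∂μ.inv = ∫ x, u x⁻¹ ∂μ := by
    rw [Measure.inv_def]
    exact (MeasurableEquiv.inv G).measurableEmbedding.integral_map u
  have key := Measure.integral_isMulLeftInvariant_isMulRightInvariant_combo (μ := μ) (ν := μ.inv)
    hf hfc g_cont g_comp g_nonneg g_one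
  rw [key, hinv, ← integral_mul_const]
  refine integral_congr_ae (Eventually.of_forall fun y => ?_)
  simp only [hinv, inv_inv, integral_mul_right_eq, mul_inv_rev, smul_eq_mul]
  rw [← modular_inv]
  field_simp

/-- The density of the right Haar measure `A ↦ μ A⁻¹` with respect to `μ`. -/
def density (x : G) : ℝ≥0∞ := ENNReal.ofReal (modular x⁻¹)

theorem measurable_density : Measurable (density : G → ℝ≥0∞) :=
  ENNReal.measurable_ofReal.comp (continuous_modular.comp continuous_inv).measurable

theorem density_mul_density_inv (x : G) : density x * density x⁻¹ = 1 := by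
  rw [density, density, ← ENNReal.ofReal_mul (modular_pos _).le, mul_comm, modular_inv_mul_self,
    ENNReal.ofReal_one]

/-- The formula for continuous functions is applied to a Urysohn function that is `1` on `K⁻¹` and
supported in a slightly larger open set. This set is kept inside a compact `C`, where the density is
bounded, so the excess is small. -/
theorem measure_le_lintegral_density (K : Set G) (hK : IsCompact K) :
    μ K ≤ ∫⁻ x in K⁻¹, density x ∂μ := by
  have hKi : IsCompact K⁻¹ := hK.inv
  obtain ⟨C, hC, hKC⟩ := exists_compact_superset hKi
  obtain ⟨c, hc⟩ := (hC.image (continuous_modular.comp continuous_inv)).bddAbove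
  have hc' : ∀ x ∈ C, density x ≤ ENNReal.ofReal c := fun x hx =>
    ENNReal.ofReal_le_ofReal (hc ⟨x, hx, rfl⟩)
  refine ENNReal.le_of_forall_pos_le_add fun ε hε _ => ?_
  obtain ⟨δ, hδ, hδε⟩ : ∃ δ : ℝ≥0, 0 < δ ∧ ENNReal.ofReal c * δ ≤ ε := by
    refine ⟨ε / (c.toNNReal + 1), by positivity, ?_⟩
    rw [ENNReal.ofReal, ← ENNReal.coe_mul, ENNReal.coe_le_coe, mul_div_assoc']
    exact div_le_of_le_mul₀ (by positivity) (by positivity) (by nlinarith [c.toNNReal.2])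
  obtain ⟨V, hKV, hVo, hV⟩ := hKi.exists_isOpen_lt_add (μ := μ) (ENNReal.coe_pos.2 hδ).ne'
  set W := V ∩ interior C
  have hWo : IsOpen W := hVo.inter isOpen_interior
  have hKW : K⁻¹ ⊆ W := Set.subset_inter hKV hKC
  obtain ⟨φ, hφ1, hφ0, hφc, hφ⟩ := exists_continuous_one_zero_of_isCompact hKi hWo.isClosed_compl
    (Set.disjoint_compl_right_iff_subset.2 hKW)
  have hcont : Continuous fun x => φ x⁻¹ := φ.continuous.comp continuous_inv
  have hcomp : HasCompactSupport fun x => φ x⁻¹ := hφc.comp_homeomorph (Homeomorph.inv G)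
  have hint := integral_comp_inv_mul_modular μ (fun x => φ x⁻¹) hcont hcomp
  simp only [inv_inv] at hint
  have hwc : Continuous fun x => φ x * modular x⁻¹ :=
    φ.continuous.mul (continuous_modular.comp continuous_inv)
  have hw : Integrable (fun x => φ x * modular x⁻¹) μ :=
    hwc.integrable_of_hasCompactSupport hφc.mul_right
  calc μ K ≤ ENNReal.ofReal (∫ x, φ x⁻¹ ∂μ) := by
        refine (hcont.integrable_of_hasCompactSupport hcomp).measure_le_integral
          (Eventually.of_forall fun x => (hφ _).1) fun x hx => ?_
        exact (hφ1 (Set.inv_mem_inv.2 hx)).ge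
    _ = ∫⁻ x, ENNReal.ofReal (φ x * modular x⁻¹) ∂μ := by
        rw [← hint, ofReal_integral_eq_lintegral_ofReal hw]
        exact Eventually.of_forall fun x => mul_nonneg (hφ _).1 (modular_pos _).le
    _ ≤ ∫⁻ x in W, density x ∂μ := by
        rw [← lintegral_indicator hWo.measurableSet]
        refine lintegral_mono fun x => ?_
        by_cases hx : x ∈ W
        · rw [Set.indicator_of_mem hx]
          exact ENNReal.ofReal_le_ofReal (mul_le_of_le_one_left (modular_pos _).le (hφ _).2)
        · simp [hφ0 hx]
    _ ≤ ∫⁻ x in K⁻¹, density x ∂μ + ∫⁻ x in W \ K⁻¹, density x ∂μ := by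
        rw [← lintegral_inter_add_sdiff _ W hKi.measurableSet,
          Set.inter_eq_right.2 hKW]
    _ ≤ _ := by
        gcongr
        calc ∫⁻ x in W \ K⁻¹, density x ∂μ ≤ ∫⁻ x in W \ K⁻¹, ENNReal.ofReal c ∂μ :=
              setLIntegral_mono measurable_const fun x hx => hc' x (interior_subset hx.1.2)
          _ = ENNReal.ofReal c * μ (W \ K⁻¹) := by simp
          _ ≤ ENNReal.ofReal c * δ := by
              gcongr
              rw [measure_sdiff hKW hKi.nullMeasurableSet hKi.measure_ne_top, tsub_le_iff_left]
              exact (measure_mono Set.inter_subset_left).trans hV.le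
          _ ≤ ε := hδε

/-- Inversion maps the right Haar measure with density `△(x⁻¹)` to the left Haar measure. -/
theorem measurePreserving_inv_withDensity :
    MeasurePreserving (fun x : G => x⁻¹) (μ.withDensity density) μ := by
  have hle : μ ≤ (μ.withDensity density).map (fun x : G => x⁻¹) := by
    refine Measure.le_iff.2 fun A hA => ?_
    rw [Measure.map_apply measurable_inv hA, withDensity_apply _ (measurable_inv hA),
      hA.measure_eq_iSup_isCompact]
    refine iSup₂_le fun K hKA => iSup_le fun hK => ?_
    exact (measure_le_lintegral_density μ K hK).trans
      (lintegral_mono_set (Set.inv_subset_inv.2 hKA))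
  refine ⟨measurable_inv, le_antisymm (Measure.le_iff.2 fun A hA => ?_) hle⟩
  have hA' : MeasurableSet ((fun x : G => x⁻¹) ⁻¹' A) := measurable_inv hA
  have h1 : (fun x : G => x⁻¹) ⁻¹' ((fun x : G => x⁻¹) ⁻¹' A) = A := by ext; simp
  rw [Measure.map_apply measurable_inv hA, withDensity_apply _ hA']
  -- The inequality `hle` implies its own reverse: enlarge `μ` to the image measure inside the
  -- integral and change variables; the two densities then multiply to `1`.
  calc ∫⁻ x in (fun x : G => x⁻¹) ⁻¹' A, density x ∂μ
      ≤ ∫⁻ x in (fun x : G => x⁻¹) ⁻¹' A, density x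
          ∂((μ.withDensity density).map (fun x : G => x⁻¹)) :=
        lintegral_mono' (Measure.restrict_mono le_rfl hle) le_rfl
    _ = ∫⁻ x in A, 1 ∂μ := by
        rw [setLIntegral_map hA' measurable_density measurable_inv, h1,
          setLIntegral_withDensity_eq_setLIntegral_mul (g := fun x => density x⁻¹) _
            measurable_density (measurable_density.comp measurable_inv) hA]
        exact lintegral_congr fun x => density_mul_density_inv x
    _ = μ A := by simp

theorem quasiMeasurePreserving_inv : Measure.QuasiMeasurePreserving (fun x : G => x⁻¹) μ μ := by
  refine ⟨measurable_inv, ?_⟩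
  have h := (measurePreserving_inv_withDensity μ).quasiMeasurePreserving.absolutelyContinuous
  refine (Measure.AbsolutelyContinuous.map ?_ measurable_inv).trans h
  refine withDensity_absolutelyContinuous' measurable_density.aemeasurable ?_
  exact Eventually.of_forall fun x => by simp [density, modular_pos]

theorem lintegral_comp_inv (f : G → ℝ≥0∞) (hf : AEMeasurable f μ) :
    ∫⁻ x, f x⁻¹ * density x ∂μ = ∫⁻ x, f x ∂μ := by
  have h := measurePreserving_inv_withDensity μ
  have h2 : AEMeasurable (fun x => f x⁻¹) μ :=
    hf.comp_quasiMeasurePreserving (quasiMeasurePreserving_inv μ)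
  conv_rhs => rw [← h.map_eq]
  rw [lintegral_map' (by rwa [h.map_eq]) measurable_inv.aemeasurable,
    lintegral_withDensity_eq_lintegral_mul₀ measurable_density.aemeasurable h2]
  exact lintegral_congr fun x => mul_comm _ _

theorem dagger_congr {f g : G → ℂ} (h : f =ᵐ[μ] g) : dagger f =ᵐ[μ] dagger g := by
  filter_upwards [(quasiMeasurePreserving_inv μ).ae_eq_comp h] with x hx
  simp only [Function.comp_apply] at hx
  rw [dagger, dagger, hx]

theorem dagger_dagger (f : G → ℂ) : dagger (dagger f) = f := by
  ext x
  simp only [dagger, inv_inv, mul_assoc, ← Complex.ofReal_mul]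
  rw [mul_comm (modular x), modular_inv_mul_self]
  simp

theorem aestronglyMeasurable_dagger {f : G → ℂ} (hf : AEStronglyMeasurable f μ) :
    AEStronglyMeasurable (dagger f) μ :=
  (hf.comp_quasiMeasurePreserving (quasiMeasurePreserving_inv μ)).mul
    (Complex.continuous_ofReal.comp
      (continuous_modular.comp continuous_inv)).aestronglyMeasurable

theorem eLpNorm_dagger {f : G → ℂ} (hf : AEStronglyMeasurable f μ) :
    eLpNorm (dagger f) 1 μ = eLpNorm f 1 μ := by
  rw [eLpNorm_one_eq_lintegral_enorm, eLpNorm_one_eq_lintegral_enorm,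
    ← lintegral_comp_inv μ _ hf.enorm]
  refine lintegral_congr fun x => ?_
  rw [dagger, enorm_mul, density]
  congr 1
  rw [← ofReal_norm, Complex.norm_real, Real.norm_of_nonneg (modular_pos _).le]

theorem memLp_one_dagger {f : G → ℂ} (hf : MemLp f 1 μ) : MemLp (dagger f) 1 μ :=
  ⟨aestronglyMeasurable_dagger μ hf.1, by rw [eLpNorm_dagger μ hf.1]; exact hf.2⟩

/-- The isometric involution `f ↦ f†` of `L₁(G)`. -/
def daggerₗᵢ : L1 μ →ₗᵢ[ℂ] L1 μ where
  toFun f := (memLp_one_dagger μ (Lp.memLp f)).toLp _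
  map_add' f g := by
    rw [← MemLp.toLp_add, MemLp.toLp_eq_toLp_iff]
    refine (dagger_congr μ (Lp.coeFn_add f g)).trans (Eventually.of_forall fun x => ?_)
    simp [dagger, add_mul]
  map_smul' c f := by
    rw [RingHom.id_apply, ← MemLp.toLp_const_smul, MemLp.toLp_eq_toLp_iff]
    refine (dagger_congr μ (Lp.coeFn_smul c f)).trans (Eventually.of_forall fun x => ?_)
    simp [dagger, mul_assoc]
  norm_map' f := by
    simp only [LinearMap.coe_mk, AddHom.coe_mk]
    rw [Lp.norm_toLp, eLpNorm_dagger μ (Lp.aestronglyMeasurable f), Lp.norm_def]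

theorem coeFn_daggerₗᵢ (f : L1 μ) : daggerₗᵢ μ f =ᵐ[μ] dagger f :=
  MemLp.coeFn_toLp (memLp_one_dagger μ (Lp.memLp f))

theorem daggerₗᵢ_daggerₗᵢ (f : L1 μ) : daggerₗᵢ μ (daggerₗᵢ μ f) = f := by
  refine Lp.ext ?_
  refine (coeFn_daggerₗᵢ μ _).trans ((dagger_congr μ (coeFn_daggerₗᵢ μ f)).trans ?_)
  rw [dagger_dagger]

theorem coeFn_leftTranslate (t : G) (f : L1 μ) :
    leftTranslate μ t f =ᵐ[μ] fun x => f (t⁻¹ * x) :=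
  Lp.coeFn_compMeasurePreserving f (measurePreserving_mul_left μ t⁻¹)

/-- Conjugation by `†` turns left translation into `R_t`, which therefore inherits isometry and
strong continuity. -/
theorem rightTranslate_eq (t : G) (f : L1 μ) :
    rightTranslate μ t f = daggerₗᵢ μ (leftTranslate μ t⁻¹ (daggerₗᵢ μ f)) := by
  refine Lp.ext ?_
  refine (MemLp.coeFn_toLp (memLp_rightTranslate μ t f)).trans ?_
  refine EventuallyEq.symm ((coeFn_daggerₗᵢ μ _).trans ?_)
  have h1 : leftTranslate μ t⁻¹ (daggerₗᵢ μ f) =ᵐ[μ] fun x => dagger f (t * x) := by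
    refine (coeFn_leftTranslate μ _ _).trans ?_
    have := (measurePreserving_mul_left μ t⁻¹⁻¹).quasiMeasurePreserving.ae_eq_comp
      (coeFn_daggerₗᵢ μ f)
    filter_upwards [this] with x hx
    simpa using hx
  refine (dagger_congr μ h1).trans (Eventually.of_forall fun x => ?_)
  simp only [dagger, mul_inv_rev, inv_inv, mul_assoc, modular_mul, Complex.ofReal_mul]
  congr 1
  rw [mul_comm, mul_assoc, ← Complex.ofReal_mul, modular_inv_mul_self,
    Complex.ofReal_one, mul_one]

theorem rho_eq (F : Compacts G) : rho μ F = daggerₗᵢ μ (lam μ F) := by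
  refine Lp.ext ((MemLp.coeFn_toLp (memLp_dagger μ F)).trans ?_)
  exact ((coeFn_daggerₗᵢ μ _).trans (dagger_congr μ indicatorConstLp_coeFn)).symm

end Modular

/-! ### Left and right translations as commuting isometries of `L₁(G)` -/

section Translations

variable {G : Type*} [Group G] [TopologicalSpace G] [IsTopologicalGroup G] [T2Space G]
  [LocallyCompactSpace G] [MeasurableSpace G] [BorelSpace G]
  (μ : Measure G) [μ.IsHaarMeasure] [μ.InnerRegular]

/-- Left translation as a linear isometry of `L₁(G)`. -/
def leftTranslateₗᵢ (t : G) : L1 μ →ₗᵢ[ℂ] L1 μ :=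
  Lp.compMeasurePreservingₗᵢ ℂ (fun x => t⁻¹ * x) (measurePreserving_mul_left μ t⁻¹)

theorem leftTranslateₗᵢ_apply (t : G) (f : L1 μ) : leftTranslateₗᵢ μ t f = leftTranslate μ t f :=
  rfl

theorem continuous_leftTranslateₗᵢ (f : L1 μ) : Continuous fun t => leftTranslateₗᵢ μ t f := by
  have : Fact ((1 : ℝ≥0∞) ≠ ∞) := ⟨ENNReal.one_ne_top⟩
  exact ((DomMulAct.continuous_mk.comp continuous_inv).smul continuous_const :
    Continuous fun t : G => DomMulAct.mk t⁻¹ • f)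

/-- Normalised right translation as a linear isometry of `L₁(G)`. -/
def rightTranslateₗᵢ (t : G) : L1 μ →ₗᵢ[ℂ] L1 μ :=
  (daggerₗᵢ μ).comp ((leftTranslateₗᵢ μ t⁻¹).comp (daggerₗᵢ μ))

theorem rightTranslateₗᵢ_apply (t : G) (f : L1 μ) :
    rightTranslateₗᵢ μ t f = rightTranslate μ t f :=
  (rightTranslate_eq μ t f).symm

theorem continuous_rightTranslateₗᵢ (f : L1 μ) : Continuous fun t => rightTranslateₗᵢ μ t f :=
  (daggerₗᵢ μ).continuous.comp ((continuous_leftTranslateₗᵢ μ (daggerₗᵢ μ f)).comp continuous_inv)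

theorem coeFn_rightTranslateₗᵢ (t : G) (f : L1 μ) :
    rightTranslateₗᵢ μ t f =ᵐ[μ] fun x => f (x * t⁻¹) * (modular t⁻¹ : ℂ) := by
  rw [rightTranslateₗᵢ_apply]
  exact MemLp.coeFn_toLp (memLp_rightTranslate μ t f)

theorem leftTranslateₗᵢ_mul (s t : G) (f : L1 μ) :
    leftTranslateₗᵢ μ (s * t) f = leftTranslateₗᵢ μ s (leftTranslateₗᵢ μ t f) := by
  refine Lp.ext ((coeFn_leftTranslate μ _ _).trans (EventuallyEq.symm ?_))
  refine (coeFn_leftTranslate μ _ _).trans ?_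
  refine ((measurePreserving_mul_left μ s⁻¹).quasiMeasurePreserving.ae_eq_comp
    (coeFn_leftTranslate μ t f)).trans (Eventually.of_forall fun x => ?_)
  simp [mul_assoc]

theorem quasiMeasurePreserving_mul_right (t : G) :
    Measure.QuasiMeasurePreserving (fun x : G => x * t) μ μ := by
  refine ⟨measurable_mul_const t, ?_⟩
  rw [Measure.map_right_mul_eq_modularCharacterFun_smul μ t]
  exact Measure.smul_absolutelyContinuous

theorem rightTranslateₗᵢ_leftTranslateₗᵢ (s t : G) (f : L1 μ) :
    rightTranslateₗᵢ μ s (leftTranslateₗᵢ μ t f) =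
      leftTranslateₗᵢ μ t (rightTranslateₗᵢ μ s f) := by
  refine Lp.ext ((coeFn_rightTranslateₗᵢ μ _ _).trans (EventuallyEq.symm ?_))
  refine (coeFn_leftTranslate μ _ _).trans ?_
  have h1 := (measurePreserving_mul_left μ t⁻¹).quasiMeasurePreserving.ae_eq_comp
    (coeFn_rightTranslateₗᵢ μ s f)
  have h2 := (quasiMeasurePreserving_mul_right μ s⁻¹).ae_eq_comp (coeFn_leftTranslate μ t f)
  filter_upwards [h1, h2] with x hx1 hx2
  simp only [Function.comp_apply] at hx1 hx2
  rw [hx1, leftTranslateₗᵢ_apply, hx2, mul_assoc]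

theorem norm_leftTranslateₗᵢ_inv_sub (s : G) (f : L1 μ) :
    ‖leftTranslateₗᵢ μ s⁻¹ f - f‖ = ‖leftTranslateₗᵢ μ s f - f‖ := by
  have h1 : leftTranslateₗᵢ μ s (leftTranslateₗᵢ μ s⁻¹ f) = f := by
    rw [← leftTranslateₗᵢ_mul, mul_inv_cancel]
    refine Lp.ext ((coeFn_leftTranslate μ _ _).trans (Eventually.of_forall fun x => ?_))
    simp
  rw [← (leftTranslateₗᵢ μ s).norm_map, map_sub, h1, norm_sub_rev]

/-- Transfers the asymptotic left invariance of `λ_γ` to asymptotic right invariance of `ρ_γ =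
λ_γ†`. -/
theorem norm_rightTranslateₗᵢ_dagger_sub (s : G) (f : L1 μ) :
    ‖rightTranslateₗᵢ μ s (daggerₗᵢ μ f) - daggerₗᵢ μ f‖ = ‖leftTranslateₗᵢ μ s f - f‖ := by
  rw [← norm_leftTranslateₗᵢ_inv_sub, ← (daggerₗᵢ μ).norm_map (leftTranslateₗᵢ μ s⁻¹ f - f),
    map_sub]
  change ‖daggerₗᵢ μ (leftTranslateₗᵢ μ s⁻¹ (daggerₗᵢ μ (daggerₗᵢ μ f))) - _‖ = _
  rw [daggerₗᵢ_daggerₗᵢ]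

end Translations

/-! ### Integrating a strongly continuous family of isometries against `L₁` -/

section Average

variable {G : Type*} [TopologicalSpace G] [R1Space G] [LocallyCompactSpace G] [MeasurableSpace G]
  [BorelSpace G] (μ : Measure G) [μ.InnerRegular] [IsFiniteMeasureOnCompacts μ]
  {E : Type*} [NormedAddCommGroup E] [NormedSpace ℂ E]

/-- An integrable scalar function times a bounded continuous vector-valued function is integrable,
even if the measure is not `σ`-finite. -/
theorem integrable_smul_of_continuous {f : G → ℂ} (hf : Integrable f μ) {v : G → E}
    (hv : Continuous v) (C : ℝ) (hC : ∀ t, ‖v t‖ ≤ C) : Integrable (fun t => f t • v t) μ := by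
  have hS (S : Set G) (hS : MeasurableSet S) (hfin : μ S ≠ ∞) :
      AEStronglyMeasurable v (μ.restrict S) := by
    have hK (n : ℕ) := hS.exists_isCompact_isClosed_sdiff_lt hfin (ε := (n + 1 : ℝ≥0∞)⁻¹) (by simp)
    -- Up to a null set, a set of finite measure is a countable union of compact sets, and on each
    -- of them the continuous `v` is strongly measurable.
    choose K hKS hKc hKcl hKm using hK
    have hae : (⋃ n, K n : Set G) =ᵐ[μ] S := by
      refine (Set.iUnion_subset hKS).eventuallyLE.antisymm (ae_le_set.2 ?_)
      refine le_antisymm (ENNReal.le_of_forall_pos_le_add fun ε hε _ => ?_) bot_le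
      obtain ⟨n, hn⟩ := ENNReal.exists_inv_nat_lt (ENNReal.coe_pos.2 hε).ne'
      rw [zero_add]
      calc μ (S \ ⋃ n, K n) ≤ μ (S \ K n) :=
            measure_mono (Set.sdiff_subset_sdiff_right (Set.subset_iUnion K n))
        _ ≤ (n + 1 : ℝ≥0∞)⁻¹ := (hKm n).le
        _ ≤ (n : ℝ≥0∞)⁻¹ := ENNReal.inv_le_inv.2 le_self_add
        _ ≤ ε := hn.le
    rw [← Measure.restrict_congr_set hae, aestronglyMeasurable_iUnion_iff]
    intro n
    exact hv.continuousOn.aestronglyMeasurable_of_isCompact (hKc n) (hKcl n).measurableSet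
  obtain ⟨f', hf', hff'⟩ := hf.aefinStronglyMeasurable
  obtain ⟨s, hs, hlim⟩ := hf'
  have hmeas : AEStronglyMeasurable (fun t => f t • v t) μ := by
    have h' : AEStronglyMeasurable (fun t => f' t • v t) μ := by
      refine aestronglyMeasurable_of_tendsto_ae atTop (f := fun n t => s n t • v t) (fun n => ?_)
        (Eventually.of_forall fun t => (hlim t).smul_const _)
      have hsupp : MeasurableSet (Function.support (s n)) := (s n).measurableSet_support
      have h1 : (fun t => s n t • v t) = (Function.support (s n)).indicator
          (fun t => s n t • v t) := by
        refine (Set.indicator_eq_self.2 fun t ht => ?_).symm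
        intro h0
        exact ht (by simp [h0])
      rw [h1, aestronglyMeasurable_indicator_iff hsupp]
      exact (s n).stronglyMeasurable.aestronglyMeasurable.smul (hS _ hsupp (hs n).ne)
    refine h'.congr ?_
    filter_upwards [hff'] with t ht
    rw [ht]
  refine (hf.norm.mul_const C).mono' hmeas (Eventually.of_forall fun t => ?_)
  rw [norm_smul]
  exact mul_le_mul_of_nonneg_left (hC t) (norm_nonneg _)

theorem integrable_smul_isometry (f : Lp ℂ 1 μ) {U : G → E →ₗᵢ[ℂ] E}
    (hU : ∀ x, Continuous fun s => U s x) (x : E) : Integrable (fun s => f s • U s x) μ :=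
  integrable_smul_of_continuous μ (L1.integrable_coeFn f) (hU x) ‖x‖
    fun t => ((U t).norm_map x).le

/-- The action `x ↦ ∫ f(s) U_s x ds` of `f ∈ L₁` that integrates a strongly continuous family of
isometries. -/
def average (U : G → E →ₗᵢ[ℂ] E) (hU : ∀ x, Continuous fun s => U s x) :
    Lp ℂ 1 μ →L[ℂ] E →L[ℂ] E :=
  LinearMap.mkContinuous₂ (LinearMap.mk₂ ℂ (fun (f : Lp ℂ 1 μ) x => ∫ s, f s • U s x ∂μ)
    (fun f g x => by
      rw [← integral_add (integrable_smul_isometry μ f hU x) (integrable_smul_isometry μ g hU x)]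
      refine integral_congr_ae ?_
      filter_upwards [Lp.coeFn_add f g] with s hs
      rw [hs, Pi.add_apply, add_smul])
    (fun c f x => by
      rw [← integral_smul]
      refine integral_congr_ae ?_
      filter_upwards [Lp.coeFn_smul c f] with s hs
      rw [hs, Pi.smul_apply, smul_assoc])
    (fun f x y => by
      rw [← integral_add (integrable_smul_isometry μ f hU x) (integrable_smul_isometry μ f hU y)]
      simp only [map_add, smul_add])
    (fun c f x => by
      rw [← integral_smul]
      simp only [map_smul, smul_comm c])) 1 fun f x => by
    rw [LinearMap.mk₂_apply, one_mul, L1.norm_eq_integral_norm, ← integral_mul_const]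
    refine norm_integral_le_of_norm_le ((L1.integrable_coeFn f).norm.mul_const _)
      (Eventually.of_forall fun s => ?_)
    rw [norm_smul, (U s).norm_map]

theorem average_apply (U : G → E →ₗᵢ[ℂ] E) (hU : ∀ x, Continuous fun s => U s x) (f : Lp ℂ 1 μ)
    (x : E) : average μ U hU f x = ∫ s, f s • U s x ∂μ := rfl

theorem map_average [CompleteSpace E] {F : Type*} [NormedAddCommGroup F] [NormedSpace ℂ F]
    [CompleteSpace F] (A : E →L[ℂ] F) (U : G → E →ₗᵢ[ℂ] E) (hU : ∀ x, Continuous fun s => U s x)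
    (f : Lp ℂ 1 μ) (x : E) : A (average μ U hU f x) = ∫ s, f s • A (U s x) ∂μ := by
  rw [average_apply, ← A.integral_comp_comm (integrable_smul_isometry μ f hU x)]
  simp only [map_smul]

theorem map_average_of_commute [CompleteSpace E] (A : E →ₗᵢ[ℂ] E) (U : G → E →ₗᵢ[ℂ] E)
    (hU : ∀ x, Continuous fun s => U s x) (hA : ∀ s x, A (U s x) = U s (A x)) (f : Lp ℂ 1 μ)
    (x : E) : A (average μ U hU f x) = average μ U hU f (A x) := by
  rw [average_apply μ U hU f (A x)]
  simp only [← hA]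
  exact map_average μ A.toContinuousLinearMap U hU f x

theorem norm_average_apply_le (U : G → E →ₗᵢ[ℂ] E) (hU : ∀ x, Continuous fun s => U s x)
    (f : Lp ℂ 1 μ) (x : E) : ‖average μ U hU f x‖ ≤ ‖f‖ * ‖x‖ := by
  have h := ContinuousLinearMap.le_opNorm₂ (average μ U hU) f x
  refine h.trans ?_
  rw [mul_assoc]
  exact mul_le_of_le_one_left (by positivity) (LinearMap.mkContinuous₂_norm_le _ zero_le_one _)

/-- The compactly supported continuous functions in `L₁`. -/
def compactlySupported (g : {g : G → ℂ // Continuous g ∧ HasCompactSupport g}) : Lp ℂ 1 μ :=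
  (memLp_one_iff_integrable.2 (g.2.1.integrable_of_hasCompactSupport g.2.2)).toLp g.1

theorem coeFn_compactlySupported (g : {g : G → ℂ // Continuous g ∧ HasCompactSupport g}) :
    compactlySupported μ g =ᵐ[μ] g.1 :=
  MemLp.coeFn_toLp _

/-- Outer regularity is used only at a compact `K ⊆ A`, so the open set `V ⊇ K` need not contain
`A`. A Urysohn function for `K ⊆ V` differs from the indicator of `A` only on `V \ K` and `A \ K`.
-/
theorem exists_compactlySupported_sub_indicator_le (c : ℂ) {A : Set G}
    (hA : MeasurableSet A) (hμA : μ A < ∞) {ε : ℝ≥0∞} (hε : ε ≠ 0) :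
    ∃ g : G → ℂ, eLpNorm (g - A.indicator fun _ => c) 1 μ ≤ ε ∧
      Continuous g ∧ HasCompactSupport g := by
  obtain ⟨δ, hδ, hδε⟩ : ∃ δ : ℝ≥0∞, δ ≠ 0 ∧ ‖c‖ₑ * (δ + δ) ≤ ε := by
    refine ⟨ε / (2 * (‖c‖ₑ + 1)), ENNReal.div_ne_zero.2 ⟨hε, by finiteness⟩, ?_⟩
    calc ‖c‖ₑ * (ε / (2 * (‖c‖ₑ + 1)) + ε / (2 * (‖c‖ₑ + 1)))
        = 2 * ‖c‖ₑ * (ε / (2 * (‖c‖ₑ + 1))) := by ring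
      _ ≤ 2 * (‖c‖ₑ + 1) * (ε / (2 * (‖c‖ₑ + 1))) := by gcongr; exact le_self_add
      _ ≤ ε := ENNReal.mul_div_le
  obtain ⟨K, hKA, hK, hKcl, hμK⟩ := hA.exists_isCompact_isClosed_sdiff_lt hμA.ne hδ
  obtain ⟨V, hKV, hVo, hV⟩ := hK.exists_isOpen_lt_add (μ := μ) hδ
  have hVK : μ (V \ K) ≤ δ := by
    rw [measure_sdiff hKV hKcl.measurableSet.nullMeasurableSet hK.measure_ne_top,
      tsub_le_iff_left]
    exact hV.le
  obtain ⟨φ, hφ1, hφ0, hφc, hφ⟩ := exists_continuous_one_zero_of_isCompact hK hVo.isClosed_compl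
    (Set.disjoint_compl_right_iff_subset.2 hKV)
  refine ⟨fun x => c * (φ x : ℂ), ?_,
    continuous_const.mul (Complex.continuous_ofReal.comp φ.continuous), ?_⟩
  · rw [eLpNorm_one_eq_lintegral_enorm]
    calc ∫⁻ x, ‖((fun x => c * (φ x : ℂ)) - A.indicator fun _ => c) x‖ₑ ∂μ
        ≤ ∫⁻ x, ‖c‖ₑ * ((V \ K).indicator 1 x + (A \ K).indicator 1 x) ∂μ := by
          refine lintegral_mono fun x => ?_
          have hx : ((fun x => c * (φ x : ℂ)) - A.indicator fun _ => c) x =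
              c * ((φ x - A.indicator 1 x : ℝ) : ℂ) := by
            by_cases hx : x ∈ A <;> simp [hx, mul_sub]
          rw [hx, enorm_mul]
          gcongr
          rw [← ofReal_norm, Complex.norm_real, Real.norm_eq_abs]
          have h0 := (hφ x).1
          have h1 := (hφ x).2
          by_cases hxK : x ∈ K
          · simp [hφ1 hxK, hKA hxK]
          by_cases hxA : x ∈ A
          · refine le_trans ?_ le_add_self
            rw [Set.indicator_of_mem hxA, Set.indicator_of_mem (show x ∈ A \ K from ⟨hxA, hxK⟩), Pi.one_apply,
              Pi.one_apply, ENNReal.ofReal_le_one, abs_le]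
            constructor <;> linarith
          by_cases hxV : x ∈ V
          · refine le_trans ?_ le_self_add
            rw [Set.indicator_of_notMem hxA, Set.indicator_of_mem (show x ∈ V \ K from ⟨hxV, hxK⟩),
              Pi.one_apply, ENNReal.ofReal_le_one, abs_le]
            constructor <;> linarith
          · simp [hφ0 hxV, hxA]
      _ = ‖c‖ₑ * (μ (V \ K) + μ (A \ K)) := by
          rw [lintegral_const_mul' _ _ (by finiteness), lintegral_add_left,
            lintegral_indicator_one, lintegral_indicator_one]
          · exact hA.diff hKcl.measurableSet
          · exact hVo.measurableSet.diff hKcl.measurableSet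
          · exact measurable_one.indicator (hVo.measurableSet.diff hKcl.measurableSet)
      _ ≤ ‖c‖ₑ * (δ + δ) := by gcongr
      _ ≤ ε := hδε
  · refine HasCompactSupport.mul_left ?_
    exact hφc.comp_left (g := fun r : ℝ => (r : ℂ)) Complex.ofReal_zero

theorem denseRange_compactlySupported : DenseRange (compactlySupported μ) := by
  refine Metric.denseRange_iff.2 fun f r hr => ?_
  obtain ⟨g, hfg, hg⟩ := (Lp.memLp f).induction_dense ENNReal.one_ne_top
    (fun g => Continuous g ∧ HasCompactSupport g)
    (fun c A hA hμA ε hε => exists_compactlySupported_sub_indicator_le μ c hA hμA hε)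
    (fun g h hg hh => ⟨hg.1.add hh.1, hg.2.add hh.2⟩)
    (fun g hg => (hg.1.integrable_of_hasCompactSupport hg.2).aestronglyMeasurable)
    (ε := ENNReal.ofReal (r / 2)) (by simpa using hr)
  refine ⟨⟨g, hg⟩, ?_⟩
  rw [Lp.dist_def, eLpNorm_congr_ae
    ((EventuallyEq.refl _ _).sub (coeFn_compactlySupported μ ⟨g, hg⟩))]
  exact (ENNReal.toReal_le_of_le_ofReal (by positivity) hfg).trans_lt (by linarith)

/-- An integrable function that is orthogonal to all bounded continuous functions vanishes. -/
theorem eq_zero_of_integral_mul_continuous (f : Lp ℂ 1 μ)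
    (hf : ∀ h : G → ℂ, Continuous h → (∀ x, ‖h x‖ ≤ 1) → ∫ x, f x * h x ∂μ = 0) : f = 0 := by
  refine norm_le_zero_iff.1 (le_of_forall_pos_le_add fun ε hε => ?_)
  obtain ⟨⟨φ, hφ, hφc⟩, hfφ⟩ :=
    Metric.denseRange_iff.1 (denseRange_compactlySupported μ) f (ε / 2) (by positivity)
  set g := compactlySupported μ ⟨φ, hφ, hφc⟩
  have hgφ : g =ᵐ[μ] φ := coeFn_compactlySupported μ _
  have hint : Integrable φ μ := hφ.integrable_of_hasCompactSupport hφc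
  have hh (h : G → ℂ) (hh : Continuous h) (hb : ∀ x, ‖h x‖ ≤ 1) :
      ‖∫ x, φ x * h x ∂μ‖ ≤ ‖f - g‖ := by
    have h1 : ∫ x, φ x * h x ∂μ = ∫ x, (φ x - f x) * h x ∂μ := by
      have i1 : Integrable (fun x => φ x * h x) μ := hint.mul_bdd hh.aestronglyMeasurable
        (Eventually.of_forall hb)
      have i2 : Integrable (fun x => f x * h x) μ := (L1.integrable_coeFn f).mul_bdd
        hh.aestronglyMeasurable (Eventually.of_forall hb)
      simp only [sub_mul]
      rw [integral_sub i1 i2, hf h hh hb, sub_zero]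
    rw [h1, norm_sub_rev, L1.norm_eq_integral_norm]
    refine norm_integral_le_of_norm_le (L1.integrable_coeFn _).norm ?_
    filter_upwards [hgφ, Lp.coeFn_sub g f] with x hx hx2
    rw [hx2, Pi.sub_apply, hx, norm_mul]
    exact mul_le_of_le_one_right (norm_nonneg _) (hb x)
  have hM : ∀ δ > 0, ‖g‖ ≤ ‖f - g‖ + μ.real (tsupport φ) * δ := by
    intro δ hδ
    have hpos (x : G) : 0 < ‖φ x‖ + δ := by positivity
    -- A continuous substitute for the conjugate phase of `φ`: pairing it with `φ` recovers `‖φ‖₁`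
    -- up to `δ` times the measure of the support.
    have hcont : Continuous fun x => star (φ x) * ((‖φ x‖ + δ : ℝ) : ℂ)⁻¹ :=
      hφ.star.mul ((Complex.continuous_ofReal.comp (hφ.norm.add continuous_const)).inv₀
        fun x => Complex.ofReal_ne_zero.2 (hpos x).ne')
    have hb (x : G) : ‖star (φ x) * ((‖φ x‖ + δ : ℝ) : ℂ)⁻¹‖ ≤ 1 := by
      rw [norm_mul, norm_star, norm_inv, Complex.norm_real, Real.norm_of_nonneg (hpos x).le,
        ← div_eq_mul_inv]
      exact (div_le_one (hpos x)).2 (by linarith)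
    have h1 := hh _ hcont hb
    have h2 : ∀ x, φ x * (star (φ x) * ((‖φ x‖ + δ : ℝ) : ℂ)⁻¹) =
        ((‖φ x‖ ^ 2 / (‖φ x‖ + δ) : ℝ) : ℂ) := by
      intro x
      rw [← mul_assoc, ← div_eq_mul_inv, Complex.ofReal_div]
      congr 1
      simpa using Complex.mul_conj' (φ x)
    simp only [h2] at h1
    rw [integral_complex_ofReal, Complex.norm_real] at h1
    have hi : Integrable (fun x => ‖φ x‖ ^ 2 / (‖φ x‖ + δ)) μ := by
      refine Continuous.integrable_of_hasCompactSupport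
        ((hφ.norm.pow 2).div (hφ.norm.add continuous_const) fun x => (hpos x).ne') ?_
      refine hφc.mono fun x hx => ?_
      contrapose! hx
      simp only [Function.mem_support, not_not] at hx ⊢
      simp [hx]
    have hK : IsCompact (tsupport φ) := hφc
    have hi2 : Integrable ((tsupport φ).indicator fun _ => δ) μ :=
      (integrable_indicator_iff (isClosed_tsupport φ).measurableSet).2
        (integrableOn_const hK.measure_ne_top)
    calc ‖g‖ = ∫ x, ‖φ x‖ ∂μ := by
          rw [L1.norm_eq_integral_norm]
          exact integral_congr_ae (hgφ.fun_comp norm)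
      _ ≤ ∫ x, (‖φ x‖ ^ 2 / (‖φ x‖ + δ) + (tsupport φ).indicator (fun _ => δ) x) ∂μ := by
          refine integral_mono hint.norm (hi.add hi2) fun x => ?_
          by_cases hx : x ∈ tsupport φ
          · simp only [Set.indicator_of_mem hx]
            rw [← sub_le_iff_le_add, le_div_iff₀ (hpos x)]
            nlinarith
          · simp [image_eq_zero_of_notMem_tsupport hx, hx]
      _ = ∫ x, ‖φ x‖ ^ 2 / (‖φ x‖ + δ) ∂μ + μ.real (tsupport φ) * δ := by
          rw [integral_add hi hi2, integral_indicator_const _ (isClosed_tsupport φ).measurableSet,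
            smul_eq_mul]
      _ ≤ ‖f - g‖ + μ.real (tsupport φ) * δ := by
          gcongr
          exact (le_abs_self _).trans h1
  have hg : ‖g‖ ≤ ‖f - g‖ := by
    refine le_of_forall_pos_le_add fun η hη => ?_
    have hμ : 0 < μ.real (tsupport φ) + 1 := by positivity
    refine (hM (η / (μ.real (tsupport φ) + 1)) (by positivity)).trans ?_
    gcongr
    rw [mul_div_assoc', div_le_iff₀ hμ]
    nlinarith
  rw [dist_eq_norm] at hfφ
  have := norm_sub_norm_le f g
  linarith

/-- If `U_s x` is close to `x` for `s` in a large compact set, then the average of `U_s x` with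
respect to `f ∈ L₁` is close to `(∫ f) x`. -/
theorem exists_isCompact_norm_average_sub_le [CompleteSpace E] (f : Lp ℂ 1 μ) {ε : ℝ} (hε : 0 < ε) :
    ∃ C : Set G, IsCompact C ∧ ∃ δ > 0, ∀ (U : G → E →ₗᵢ[ℂ] E)
      (hU : ∀ x, Continuous fun s => U s x) (x : E), ‖x‖ ≤ 1 → (∀ s ∈ C, ‖U s x - x‖ ≤ δ) →
      ‖average μ U hU f x - (∫ s, f s ∂μ) • x‖ ≤ ε := by
  obtain ⟨⟨φ, hφ, hφc⟩, hfφ⟩ :=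
    Metric.denseRange_iff.1 (denseRange_compactlySupported μ) f (ε / 4) (by positivity)
  set g := compactlySupported μ ⟨φ, hφ, hφc⟩
  have hgφ : g =ᵐ[μ] φ := coeFn_compactlySupported μ _
  -- The error splits into `δ ‖g‖ ≤ ε / 2` on the support of `φ` and `2 ‖f - g‖ ≤ ε / 2` from the
  -- approximation. Neither `C` nor `δ` depends on `U` or `x`.
  refine ⟨tsupport φ, hφc, ε / (2 * (‖g‖ + 1)), by positivity, fun U hU x hx hUx => ?_⟩
  set δ := ε / (2 * (‖g‖ + 1))
  have hδ : 0 ≤ δ := by positivity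
  have hd (s : G) : ‖U s x - x‖ ≤ 2 := by
    refine (norm_sub_le _ _).trans ?_
    rw [(U s).norm_map]
    linarith
  rw [average_apply, ← integral_smul_const, ← integral_sub (integrable_smul_isometry μ f hU x)
    ((L1.integrable_coeFn f).smul_const x)]
  simp only [← smul_sub]
  have hb : ∀ᵐ s ∂μ, ‖f s • (U s x - x)‖ ≤ δ * ‖g s‖ + 2 * ‖(f - g : Lp ℂ 1 μ) s‖ := by
    filter_upwards [hgφ, Lp.coeFn_sub f g] with s hs hs2
    rw [norm_smul, hs2, Pi.sub_apply]
    have h1 : ‖f s‖ ≤ ‖g s‖ + ‖f s - g s‖ := by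
      have := norm_sub_norm_le (f s) (g s)
      linarith
    have h2 : ‖g s‖ * ‖U s x - x‖ ≤ δ * ‖g s‖ := by
      by_cases hsφ : s ∈ tsupport φ
      · rw [mul_comm δ]
        exact mul_le_mul_of_nonneg_left (hUx s hsφ) (norm_nonneg _)
      · simp [hs, image_eq_zero_of_notMem_tsupport hsφ]
    have h3 := mul_le_mul_of_nonneg_right h1 (norm_nonneg (U s x - x))
    have h4 := mul_le_mul_of_nonneg_left (hd s) (norm_nonneg (f s - g s))
    linarith
  have hi1 := (L1.integrable_coeFn g).norm.const_mul δ
  have hi2 := (L1.integrable_coeFn (f - g)).norm.const_mul 2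
  refine (norm_integral_le_of_norm_le (hi1.add hi2) hb).trans ?_
  simp only [Pi.add_apply]
  rw [integral_add hi1 hi2, integral_const_mul, integral_const_mul, ← L1.norm_eq_integral_norm,
    ← L1.norm_eq_integral_norm]
  rw [dist_eq_norm] at hfφ
  have : δ * ‖g‖ ≤ ε / 2 := by
    rw [div_mul_eq_mul_div, div_le_iff₀ (by positivity)]
    nlinarith
  linarith

end Average

/-! ### Convolution as an average of left or of right translates -/

section Convolution

variable {G : Type*} [Group G] [TopologicalSpace G] [IsTopologicalGroup G] [T2Space G]
  [LocallyCompactSpace G] [MeasurableSpace G] [BorelSpace G]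
  (μ : Measure G) [μ.IsHaarMeasure] [μ.InnerRegular]

theorem ae_norm_le_norm_Linf (T : Linf μ) : ∀ᵐ x ∂μ, ‖T x‖ ≤ ‖T‖ := by
  have h : ∀ᵐ x ∂μ, ‖T x‖ₑ ≤ eLpNorm T ∞ μ := by
    rw [eLpNorm_exponent_top]
    exact ae_le_eLpNormEssSup
  filter_upwards [h] with x hx
  rw [Lp.norm_def, ← toReal_enorm]
  exact ENNReal.toReal_mono (Lp.eLpNorm_ne_top T) hx

/-- Evaluation of `toDual` at `T`, as a functional on `L₁(G)`. -/
def pairing (T : Linf μ) : L1 μ →L[ℂ] ℂ := ((ContinuousLinearMap.mul ℂ ℂ).lpPairing μ 1 ∞).flip T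

theorem pairing_apply (T : Linf μ) (f : L1 μ) : pairing μ T f = toDual μ f T := rfl

theorem conv_eq_average (f g : L1 μ) :
    conv μ f g = average μ (leftTranslateₗᵢ μ) (continuous_leftTranslateₗᵢ μ) f g := rfl

theorem toDual_average (U : G → L1 μ →ₗᵢ[ℂ] L1 μ) (hU : ∀ x, Continuous fun s => U s x)
    (f x : L1 μ) (T : Linf μ) :
    toDual μ (average μ U hU f x) T = ∫ s, f s * toDual μ (U s x) T ∂μ :=
  map_average μ (pairing μ T) U hU f x

theorem integral_integral_mul_swap {φ ψ h : G → ℂ} (hφ : Continuous φ)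
    (hφc : HasCompactSupport φ) (hψ : Continuous ψ) (hψc : HasCompactSupport ψ)
    (hh : Continuous h) :
    ∫ s, φ s * ∫ x, ψ x * h (s * x) ∂μ ∂μ = ∫ x, ψ x * ∫ s, φ s * h (s * x) ∂μ ∂μ := by
  simp only [← integral_const_mul]
  rw [integral_integral_swap_of_hasCompactSupport (f := fun s x => φ s * (ψ x * h (s * x)))]
  · simp only [mul_left_comm]
  · exact (hφ.comp continuous_fst).mul ((hψ.comp continuous_snd).mul (hh.comp continuous_mul))
  · refine HasCompactSupport.intro (hφc.isCompact.prod hψc.isCompact) fun z hz => ?_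
    rw [Set.mem_prod, not_and_or] at hz
    rcases hz with hz | hz <;> simp [Function.uncurry, image_eq_zero_of_notMem_tsupport hz]

/-- `f * g = ∫ g(t) R_t f dt`. -/
theorem conv_eq_average_rightTranslate (f g : L1 μ) :
    conv μ f g = average μ (rightTranslateₗᵢ μ) (continuous_rightTranslateₗᵢ μ) g f := by
  rw [conv_eq_average]
  -- Both sides are jointly continuous, so compactly supported `φ`, `ψ` suffice. Tested against a
  -- bounded continuous `h`, both sides are iterated integrals of `φ(s) ψ(x) h(s x)`.
  refine (denseRange_compactlySupported μ).induction_on₂ (isClosed_eq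
    (((average μ _ _).continuous.comp continuous_fst).clm_apply continuous_snd)
    (((average μ _ _).continuous.comp continuous_snd).clm_apply continuous_fst)) ?_ f g
  rintro ⟨φ, hφ, hφc⟩ ⟨ψ, hψ, hψc⟩
  set f := compactlySupported μ ⟨φ, hφ, hφc⟩
  set g := compactlySupported μ ⟨ψ, hψ, hψc⟩
  have hf : f =ᵐ[μ] φ := coeFn_compactlySupported μ _
  have hg : g =ᵐ[μ] ψ := coeFn_compactlySupported μ _
  rw [← sub_eq_zero]
  refine eq_zero_of_integral_mul_continuous μ _ fun h hh hb => ?_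
  set H : Linf μ :=
    (memLp_top_of_bound hh.aestronglyMeasurable 1 (Eventually.of_forall hb)).toLp h
  have hH : H =ᵐ[μ] h := MemLp.coeFn_toLp _
  have hint (k : L1 μ) : toDual μ k H = ∫ x, k x * h x ∂μ := by
    rw [toDual_apply]
    refine integral_congr_ae ?_
    filter_upwards [hH] with x hx
    rw [hx]
  rw [← hint, ← pairing_apply, map_sub, sub_eq_zero, pairing_apply, pairing_apply,
    toDual_average, toDual_average]
  have hl (s : G) : toDual μ (leftTranslateₗᵢ μ s g) H = ∫ x, ψ x * h (s * x) ∂μ := by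
    rw [hint, ← integral_mul_left_eq_self _ s]
    refine integral_congr_ae ?_
    have h1 := (measurePreserving_mul_left μ s).quasiMeasurePreserving.ae_eq_comp
      (coeFn_leftTranslate μ s g)
    filter_upwards [h1, hg] with x hx hx2
    simp only [Function.comp_apply, inv_mul_cancel_left] at hx
    rw [leftTranslateₗᵢ_apply, hx, hx2]
  have hr (t : G) : toDual μ (rightTranslateₗᵢ μ t f) H = ∫ x, φ x * h (x * t) ∂μ := by
    have h1 : ∫ x, rightTranslateₗᵢ μ t f x * h x ∂μ =
        ∫ x, modular t⁻¹ • (φ (x * t⁻¹) * h (x * t⁻¹ * t)) ∂μ := by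
      refine integral_congr_ae ?_
      filter_upwards [coeFn_rightTranslateₗᵢ μ t f,
        (quasiMeasurePreserving_mul_right μ t⁻¹).ae_eq_comp hf] with x hx hx2
      simp only [Function.comp_apply] at hx2
      rw [hx, hx2, inv_mul_cancel_right, Complex.real_smul]
      ring
    rw [hint, h1, integral_smul, integral_mul_right_eq μ (fun x => φ x * h (x * t)) t⁻¹, smul_smul,
      mul_comm, modular_inv_mul_self, one_smul]
  simp only [hl, hr]
  rw [integral_congr_ae (hf.fun_mul (EventuallyEq.refl _ _)),
    integral_congr_ae (hg.fun_mul (EventuallyEq.refl _ _))]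
  exact integral_integral_mul_swap μ hφ hφc hψ hψc hh

theorem norm_conv_le (f g : L1 μ) : ‖conv μ f g‖ ≤ ‖f‖ * ‖g‖ := by
  rw [conv_eq_average]
  exact norm_average_apply_le μ _ _ f g

/-- Immediate once `f * g` is written as an average of right translates of `f`, since these commute
with `l_s`. -/
theorem leftTranslateₗᵢ_conv (s : G) (f g : L1 μ) :
    leftTranslateₗᵢ μ s (conv μ f g) = conv μ (leftTranslateₗᵢ μ s f) g := by
  rw [conv_eq_average_rightTranslate, conv_eq_average_rightTranslate]
  exact map_average_of_commute μ _ _ _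
    (fun t x => (rightTranslateₗᵢ_leftTranslateₗᵢ μ t s x).symm) g f

theorem rightTranslateₗᵢ_conv (s : G) (f g : L1 μ) :
    rightTranslateₗᵢ μ s (conv μ f g) = conv μ f (rightTranslateₗᵢ μ s g) := by
  rw [conv_eq_average, conv_eq_average]
  exact map_average_of_commute μ _ _ _
    (fun t x => rightTranslateₗᵢ_leftTranslateₗᵢ μ s t x) f g

theorem memLp_orbitCoefficient (U : G → L1 μ →ₗᵢ[ℂ] L1 μ) (hU : ∀ x, Continuous fun s => U s x)
    (x : L1 μ) (T : Linf μ) : MemLp (fun s => toDual μ (U s x) T) ∞ μ := by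
  refine memLp_top_of_bound ((pairing μ T).continuous.comp (hU x)).aestronglyMeasurable
    (‖pairing μ T‖ * ‖x‖) (Eventually.of_forall fun s => ?_)
  rw [← (U s).norm_map x]
  exact (pairing μ T).le_opNorm _

/-- The function `s ↦ ⟨U_s x, T⟩` as an element of `L_∞(G)`. -/
def orbitCoefficient (U : G → L1 μ →ₗᵢ[ℂ] L1 μ) (hU : ∀ x, Continuous fun s => U s x)
    (x : L1 μ) (T : Linf μ) : Linf μ :=
  (memLp_orbitCoefficient μ U hU x T).toLp _

theorem coeFn_orbitCoefficient (U : G → L1 μ →ₗᵢ[ℂ] L1 μ) (hU : ∀ x, Continuous fun s => U s x)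
    (x : L1 μ) (T : Linf μ) :
    orbitCoefficient μ U hU x T =ᵐ[μ] fun s => toDual μ (U s x) T :=
  MemLp.coeFn_toLp (memLp_orbitCoefficient μ U hU x T)

theorem toDual_orbitCoefficient (U : G → L1 μ →ₗᵢ[ℂ] L1 μ) (hU : ∀ x, Continuous fun s => U s x)
    (f x : L1 μ) (T : Linf μ) :
    toDual μ f (orbitCoefficient μ U hU x T) = toDual μ (average μ U hU f x) T := by
  rw [toDual_average, toDual_apply]
  refine integral_congr_ae ?_
  filter_upwards [coeFn_orbitCoefficient μ U hU x T] with s hs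
  rw [hs]

/-- Realises `fT` by the explicit function `t ↦ ⟨R_t f, T⟩`, so a bound over all translates of `f`
becomes a pointwise bound on `fT`. -/
theorem isLeftAct_orbitCoefficient (f : L1 μ) (T : Linf μ) :
    IsLeftAct μ f T
      (orbitCoefficient μ (rightTranslateₗᵢ μ) (continuous_rightTranslateₗᵢ μ) f T) := fun g => by
  rw [toDual_orbitCoefficient, conv_eq_average_rightTranslate]

theorem isRightAct_orbitCoefficient (f : L1 μ) (T : Linf μ) :
    IsRightAct μ f T
      (orbitCoefficient μ (leftTranslateₗᵢ μ) (continuous_leftTranslateₗᵢ μ) f T) := fun g => by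
  rw [toDual_orbitCoefficient, conv_eq_average]

end Convolution

/-! ### Densities as means; closedness and convexity of the sets of invariant means -/

section Means

variable {G : Type*} [Group G] [TopologicalSpace G] [IsTopologicalGroup G] [T2Space G]
  [LocallyCompactSpace G] [MeasurableSpace G] [BorelSpace G]
  (μ : Measure G) [μ.IsHaarMeasure] [μ.InnerRegular]

theorem lam_mem_P1 {F : Compacts G} (hF : 0 < μ F) : lam μ F ∈ P1 μ := by
  constructor
  · filter_upwards [show lam μ F =ᵐ[μ] _ from indicatorConstLp_coeFn] with x hx
    rw [hx]
    refine Set.indicator_nonneg (fun _ _ => ?_) x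
    rw [← Complex.ofReal_inv]
    exact Complex.zero_le_real.2 (by positivity)
  · have hpos : 0 < (μ F).toReal := ENNReal.toReal_pos hF.ne' F.isCompact.measure_ne_top
    rw [lam, norm_indicatorConstLp one_ne_zero ENNReal.one_ne_top, norm_inv, Complex.norm_real,
      Real.norm_of_nonneg hpos.le, ENNReal.toReal_one, div_one, Real.rpow_one]
    exact inv_mul_cancel₀ hpos.ne'

theorem leftTranslateₗᵢ_mem_P1 {f : L1 μ} (hf : f ∈ P1 μ) (t : G) :
    leftTranslateₗᵢ μ t f ∈ P1 μ := by
  refine ⟨?_, by rw [LinearIsometry.norm_map, hf.2]⟩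
  filter_upwards [coeFn_leftTranslate μ t f,
    (measurePreserving_mul_left μ t⁻¹).quasiMeasurePreserving.ae hf.1] with x hx hx2
  rw [leftTranslateₗᵢ_apply, hx]
  exact hx2

theorem daggerₗᵢ_mem_P1 {f : L1 μ} (hf : f ∈ P1 μ) : daggerₗᵢ μ f ∈ P1 μ := by
  refine ⟨?_, by rw [LinearIsometry.norm_map, hf.2]⟩
  filter_upwards [coeFn_daggerₗᵢ μ f, (quasiMeasurePreserving_inv μ).ae hf.1] with x hx hx2
  rw [hx]
  exact mul_nonneg hx2 (Complex.zero_le_real.2 (modular_pos _).le)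

theorem rightTranslateₗᵢ_mem_P1 {f : L1 μ} (hf : f ∈ P1 μ) (t : G) :
    rightTranslateₗᵢ μ t f ∈ P1 μ :=
  daggerₗᵢ_mem_P1 μ (leftTranslateₗᵢ_mem_P1 μ (daggerₗᵢ_mem_P1 μ hf) t⁻¹)

theorem integral_eq_one_of_mem_P1 {f : L1 μ} (hf : f ∈ P1 μ) : ∫ x, f x ∂μ = 1 := by
  have h : ∫ x, f x ∂μ = ∫ x, ((‖f x‖ : ℝ) : ℂ) ∂μ := by
    refine integral_congr_ae ?_
    filter_upwards [hf.1] with x hx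
    exact Complex.eq_coe_norm_of_nonneg hx
  rw [h, integral_complex_ofReal, ← L1.norm_eq_integral_norm, hf.2, Complex.ofReal_one]

theorem coeFn_one : one μ =ᵐ[μ] fun _ => 1 := MemLp.coeFn_toLp (memLp_top_const (1 : ℂ))

theorem toDual_one (f : L1 μ) : toDual μ f (one μ) = ∫ x, f x ∂μ := by
  rw [toDual_apply]
  refine integral_congr_ae ?_
  filter_upwards [coeFn_one μ] with x hx
  rw [hx, mul_one]

theorem toDual_mem_means {f : L1 μ} (hf : f ∈ P1 μ) : toDual μ f ∈ means μ := by
  refine ⟨fun T hT => ?_, by rw [toDual_one, integral_eq_one_of_mem_P1 μ hf]⟩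
  rw [toDual_apply]
  refine integral_nonneg_of_ae ?_
  filter_upwards [hf.1, hT] with x hx hx2
  exact mul_nonneg hx hx2

/-- Under the pairing, `f * g` is the average of the means `l_s g` with weight `f`, so no pointwise
formula for the convolution is needed. -/
theorem toDual_conv_mem_means {f g : L1 μ} (hf : f ∈ P1 μ) (hg : g ∈ P1 μ) :
    toDual μ (conv μ f g) ∈ means μ := by
  have hm (s : G) := toDual_mem_means μ (leftTranslateₗᵢ_mem_P1 μ hg s)
  refine ⟨fun T hT => ?_, ?_⟩
  · rw [conv_eq_average, toDual_average]
    refine integral_nonneg_of_ae ?_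
    filter_upwards [hf.1] with s hs
    exact mul_nonneg hs ((hm s).1 T hT)
  · rw [conv_eq_average, toDual_average]
    simp only [(hm _).2, mul_one]
    exact integral_eq_one_of_mem_P1 μ hf

theorem isClosed_means : IsClosed (means μ) := by
  have h : means μ = (⋂ (T : Linf μ) (_ : ∀ᵐ x ∂μ, 0 ≤ T x),
      {m : WeakDual ℂ (Linf μ) | 0 ≤ m T}) ∩ {m | m (one μ) = 1} := by
    ext m
    simp [means]
  rw [h]
  refine (isClosed_iInter fun T => isClosed_iInter fun _ => ?_).inter
    (isClosed_eq (WeakDual.eval_continuous _) continuous_const)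
  exact isClosed_Ici.preimage (WeakDual.eval_continuous T)

theorem convex_means : Convex ℝ (means μ) := by
  rintro m hm n hn a b ha hb hab
  have h (T : Linf μ) : (a • m + b • n) T = (a : ℂ) * m T + (b : ℂ) * n T := by
    change a • m T + b • n T = _
    rw [Complex.real_smul, Complex.real_smul]
  refine ⟨fun T hT => ?_, ?_⟩
  · rw [h]
    exact add_nonneg (mul_nonneg (Complex.zero_le_real.2 ha) (hm.1 T hT))
      (mul_nonneg (Complex.zero_le_real.2 hb) (hn.1 T hT))
  · rw [h, hm.2, hn.2, mul_one, mul_one, ← Complex.ofReal_add, hab, Complex.ofReal_one]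

theorem isClosed_setOf_invariant (P : Linf μ → Linf μ → Prop) :
    IsClosed {m : WeakDual ℂ (Linf μ) | ∀ T S, P T S → m S = m T} := by
  simp only [Set.ofPred_forall]
  exact isClosed_iInter fun T => isClosed_iInter fun S => isClosed_iInter fun _ =>
    isClosed_eq (WeakDual.eval_continuous _) (WeakDual.eval_continuous _)

theorem convex_setOf_invariant (P : Linf μ → Linf μ → Prop) :
    Convex ℝ {m : WeakDual ℂ (Linf μ) | ∀ T S, P T S → m S = m T} := by
  rintro m hm n hn a b - - - T S h
  change a • m S + b • n S = a • m T + b • n T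
  rw [hm T S h, hn T S h]

theorem TLIM_eq : TLIM μ =
    means μ ∩ {m | ∀ T S, (∃ f ∈ P1 μ, IsLeftAct μ f T S) → m S = m T} := by
  ext m
  exact and_congr_right fun _ => ⟨fun h T S ⟨f, hf, hS⟩ => h f hf T S hS,
    fun h f hf T S hS => h T S ⟨f, hf, hS⟩⟩

theorem TRIM_eq : TRIM μ =
    means μ ∩ {m | ∀ T S, (∃ f ∈ P1 μ, IsRightAct μ f T S) → m S = m T} := by
  ext m
  exact and_congr_right fun _ => ⟨fun h T S ⟨f, hf, hS⟩ => h f hf T S hS,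
    fun h f hf T S hS => h T S ⟨f, hf, hS⟩⟩

theorem isClosed_TLIM : IsClosed (TLIM μ) := by
  rw [TLIM_eq]
  exact (isClosed_means μ).inter (isClosed_setOf_invariant μ _)

theorem isClosed_TRIM : IsClosed (TRIM μ) := by
  rw [TRIM_eq]
  exact (isClosed_means μ).inter (isClosed_setOf_invariant μ _)

theorem convex_TLIM : Convex ℝ (TLIM μ) := by
  rw [TLIM_eq]
  exact (convex_means μ).inter (convex_setOf_invariant μ _)

theorem convex_TRIM : Convex ℝ (TRIM μ) := by
  rw [TRIM_eq]
  exact (convex_means μ).inter (convex_setOf_invariant μ _)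

variable {μ}

/-- For real `A` the function `‖A‖ + A` is nonnegative, and nonnegativity of a complex number
includes being real. -/
theorem im_eq_zero_of_mem_means {m : WeakDual ℂ (Linf μ)} (hm : m ∈ means μ) {A : Linf μ}
    (hA : ∀ᵐ x ∂μ, (A x).im = 0) : (m A).im = 0 := by
  have h := hm.1 ((‖A‖ : ℂ) • one μ + A) ?_
  · rw [map_add, map_smul, hm.2, smul_eq_mul, mul_one] at h
    simpa using (Complex.le_def.1 h).2.symm
  · filter_upwards [hA, Lp.coeFn_add ((‖A‖ : ℂ) • one μ) A, Lp.coeFn_smul (‖A‖ : ℂ) (one μ),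
      coeFn_one μ, ae_norm_le_norm_Linf μ A] with x h1 h2 h3 h4 h5
    rw [h2, Pi.add_apply, h3, Pi.smul_apply, h4, Complex.le_def]
    have := (abs_le.1 ((Complex.abs_re_le_norm (A x)).trans h5)).1
    constructor
    · simpa using by linarith
    · simp [h1]

/-- The real part of a mean is monotone in the real part of its argument. -/
theorem re_le_of_mem_means {m : WeakDual ℂ (Linf μ)} (hm : m ∈ means μ) {S : Linf μ} {c : ℝ}
    (hS : ∀ᵐ x ∂μ, (S x).re ≤ c) : (m S).re ≤ c := by
  set A : Linf μ := (Lp.memLp S).re.ofReal.toLp _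
  set B : Linf μ := (Lp.memLp S).im.ofReal.toLp _
  have hA : A =ᵐ[μ] fun x => ((S x).re : ℂ) := MemLp.coeFn_toLp (Lp.memLp S).re.ofReal
  have hB : B =ᵐ[μ] fun x => ((S x).im : ℂ) := MemLp.coeFn_toLp (Lp.memLp S).im.ofReal
  -- Means are real on real functions, so `Re m(S) = m(A)`, and positivity applies to `c - A`.
  have hSAB : S = A + Complex.I • B := by
    refine Lp.ext ?_
    filter_upwards [hA, hB, Lp.coeFn_add A (Complex.I • B), Lp.coeFn_smul Complex.I B]
      with x h1 h2 h3 h4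
    rw [h3, Pi.add_apply, h4, Pi.smul_apply, h1, h2, smul_eq_mul, mul_comm, Complex.re_add_im]
  have hBm : (m B).im = 0 := im_eq_zero_of_mem_means hm <| by
    filter_upwards [hB] with x hx
    rw [hx, Complex.ofReal_im]
  have h1 : (m S).re = (m A).re := by
    rw [hSAB, map_add, map_smul]
    simp [hBm]
  have h2 := hm.1 ((c : ℂ) • one μ - A) ?_
  · rw [map_sub, map_smul, hm.2, smul_eq_mul, mul_one] at h2
    have := (Complex.le_def.1 h2).1
    rw [h1]
    simpa using this
  · filter_upwards [hS, hA, Lp.coeFn_sub ((c : ℂ) • one μ) A, Lp.coeFn_smul (c : ℂ) (one μ),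
      coeFn_one μ] with x h1 h2 h3 h4 h5
    rw [h3, Pi.sub_apply, h4, Pi.smul_apply, h5, h2, smul_eq_mul, mul_one, ← Complex.ofReal_sub]
    exact Complex.zero_le_real.2 (sub_nonneg.2 h1)

end Means

/-! ### Separation of a functional from ultrafilter limits -/

section LimitSets

/-- If no weak-* continuous functional separates `m` from all the points `x γ a` with `γ` fixed,
then `m` is in the closed convex hull of the ultrafilter limits of `x`. -/
theorem mem_closure_convexHull_limitSet {Γ A E : Type*} [NormedAddCommGroup E] [NormedSpace ℂ E]
    (p : Ultrafilter Γ) (x : Γ → A → WeakDual ℂ E) (C : ℝ)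
    (hx : ∀ γ a, ‖WeakDual.toStrongDual (x γ a)‖ ≤ C) (m : WeakDual ℂ E)
    (hm : ∀ (T : E) (u : ℝ) (γ : Γ), (∀ a, (x γ a T).re ≤ u) → (m T).re ≤ u) :
    m ∈ closure (convexHull ℝ (limitSet p x)) := by
  by_contra hmem
  have : LocallyConvexSpace ℝ (WeakDual ℂ E) :=
    WeakBilin.locallyConvexSpace (B := topDualPairing ℂ E)
  have : IsScalarTower ℝ ℂ (WeakDual ℂ E) :=
    ⟨fun r c φ => ContinuousLinearMap.ext fun T => smul_assoc r c (φ T)⟩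
  have : ContinuousConstSMul ℝ (WeakDual ℂ E) := ⟨fun r => continuous_const_smul (r : ℂ)⟩
  have hconv : Convex ℝ (closure (convexHull ℝ (limitSet p x))) :=
    Convex.closure (𝕜 := ℝ) (E := WeakDual ℂ E) (convex_convexHull ℝ (limitSet p x))
  have hsep := RCLike.geometric_hahn_banach_closed_point (𝕜 := ℂ) (E := WeakDual ℂ E) hconv
    isClosed_closure hmem
  obtain ⟨φ, u, hφ, hu⟩ := hsep
  -- Weak-* continuous functionals are evaluations at points of `E`.
  obtain ⟨T, rfl⟩ := LinearMap.dualEmbedding_surjective (topDualPairing ℂ E) φ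
  change u < (m T).re at hu
  have hex (γ : Γ) : ∃ a, u < (x γ a T).re := by
    by_contra! h
    exact (hm T u γ h).not_gt hu
  choose t ht using hex
  -- The uniform bound `C` and Banach–Alaoglu make the ultrafilter converge. The limit only
  -- satisfies `Re ≥ u`, which still contradicts the strict bound on the hull.
  obtain ⟨m', -, hm'⟩ := (WeakDual.isCompact_closedBall (𝕜 := ℂ) (0 : StrongDual ℂ E) C)
    |>.ultrafilter_le_nhds (p.map fun γ => x γ (t γ)) <| by
      refine tendsto_principal.2 (Eventually.of_forall fun γ => ?_)
      simpa using hx γ (t γ)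
  have hlim : Tendsto (fun γ => x γ (t γ)) p (𝓝 m') := hm'
  have h1 : (m' T).re < u := hφ m' (subset_closure (subset_convexHull ℝ _ ⟨t, hlim⟩))
  have h2 : Tendsto (fun γ => (x γ (t γ) T).re) p (𝓝 (m' T).re) :=
    (Complex.continuous_re.tendsto _).comp (((WeakDual.eval_continuous T).tendsto m').comp hlim)
  exact (ge_of_tendsto' h2 fun γ => (ht γ).le).not_gt h1

end LimitSets

/-! ### From asymptotic invariance to topological invariance -/

section Invariance

variable {G : Type*} [Group G] [TopologicalSpace G] [IsTopologicalGroup G] [T2Space G]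
  [LocallyCompactSpace G] [MeasurableSpace G] [BorelSpace G]
  (μ : Measure G) [μ.IsHaarMeasure] [μ.InnerRegular]

/-- Asymptotic invariance on compact sets makes the average of `x i` against `f` norm-close to `x
i`, because `∫ f = 1`; pairing with `T` and passing to the limit gives the equality. Stated for
general `U` to serve both `l` and `R`. -/
theorem eq_of_tendsto_of_asymptotically_invariant {ι : Type*} {p : Filter ι} [p.NeBot]
    (U : G → L1 μ →ₗᵢ[ℂ] L1 μ) (hU : ∀ x, Continuous fun s => U s x) {x : ι → L1 μ}
    (hx : ∀ i, ‖x i‖ ≤ 1)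
    (hinv : ∀ C : Set G, IsCompact C → ∀ δ > 0, ∀ᶠ i in p, ∀ s ∈ C, ‖U s (x i) - x i‖ ≤ δ)
    {m : WeakDual ℂ (Linf μ)} (hm : Tendsto (fun i => toDual μ (x i)) p (𝓝 m))
    {f : L1 μ} (hf : f ∈ P1 μ) {T S : Linf μ}
    (hS : ∀ g, toDual μ g S = toDual μ (average μ U hU f g) T) : m S = m T := by
  have hlim (R : Linf μ) : Tendsto (fun i => toDual μ (x i) R) p (𝓝 (m R)) :=
    ((WeakDual.eval_continuous R).tendsto m).comp hm
  have h0 : Tendsto (fun i => average μ U hU f (x i) - x i) p (𝓝 0) := by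
    refine Metric.tendsto_nhds.2 fun ε hε => ?_
    obtain ⟨C, hC, δ, hδ, h⟩ := exists_isCompact_norm_average_sub_le (E := L1 μ) μ f (half_pos hε)
    filter_upwards [hinv C hC δ hδ] with i hi
    have := h U hU (x i) (hx i) hi
    rw [integral_eq_one_of_mem_P1 μ hf, one_smul] at this
    rw [dist_zero_right]
    linarith
  have h1 := ((pairing μ T).continuous.tendsto 0).comp h0
  have h2 : Tendsto (fun i => toDual μ (x i) S - toDual μ (x i) T) p (𝓝 0) := by
    rw [map_zero] at h1
    refine h1.congr fun i => ?_
    rw [Function.comp_apply, map_sub, hS]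
    rfl
  exact sub_eq_zero.1 (tendsto_nhds_unique ((hlim S).sub (hlim T)) h2)

theorem norm_toDual_le (f : L1 μ) (hf : ‖f‖ ≤ 1) :
    ‖WeakDual.toStrongDual (toDual μ f)‖ ≤ ‖(ContinuousLinearMap.mul ℂ ℂ).lpPairing μ 1 ∞‖ :=
  (((ContinuousLinearMap.mul ℂ ℂ).lpPairing μ 1 ∞).le_opNorm f).trans
    (mul_le_of_le_one_right (norm_nonneg _) hf)

/-- The limits of an asymptotically left invariant family of means are topologically left
invariant means. -/
theorem limitSet_subset_TLIM {Γ A : Type*} (p : Ultrafilter Γ) {x : Γ → A → L1 μ}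
    (hx : ∀ γ a, ‖x γ a‖ ≤ 1) (hmean : ∀ γ a, toDual μ (x γ a) ∈ means μ)
    (hinv : ∀ C : Set G, IsCompact C → ∀ δ > 0,
      ∀ᶠ γ in p, ∀ s ∈ C, ∀ a, ‖leftTranslateₗᵢ μ s (x γ a) - x γ a‖ ≤ δ) :
    limitSet p (fun γ a => toDual μ (x γ a)) ⊆ TLIM μ := by
  rintro m ⟨t, ht⟩
  refine ⟨(isClosed_means μ).mem_of_tendsto ht (Eventually.of_forall fun γ => hmean γ (t γ)),
    fun f hf T S hS => ?_⟩
  refine eq_of_tendsto_of_asymptotically_invariant μ _ (continuous_leftTranslateₗᵢ μ)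
    (fun γ => hx γ (t γ)) (fun C hC δ hδ => ?_) ht hf hS
  filter_upwards [hinv C hC δ hδ] with γ h s hs using h s hs (t γ)

theorem limitSet_subset_TRIM {Γ A : Type*} (p : Ultrafilter Γ) {x : Γ → A → L1 μ}
    (hx : ∀ γ a, ‖x γ a‖ ≤ 1) (hmean : ∀ γ a, toDual μ (x γ a) ∈ means μ)
    (hinv : ∀ C : Set G, IsCompact C → ∀ δ > 0,
      ∀ᶠ γ in p, ∀ s ∈ C, ∀ a, ‖rightTranslateₗᵢ μ s (x γ a) - x γ a‖ ≤ δ) :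
    limitSet p (fun γ a => toDual μ (x γ a)) ⊆ TRIM μ := by
  rintro m ⟨t, ht⟩
  refine ⟨(isClosed_means μ).mem_of_tendsto ht (Eventually.of_forall fun γ => hmean γ (t γ)),
    fun f hf T S hS => ?_⟩
  refine eq_of_tendsto_of_asymptotically_invariant μ _ (continuous_rightTranslateₗᵢ μ)
    (fun γ => hx γ (t γ)) (fun C hC δ hδ => ?_) ht hf
    (fun g => by rw [hS g, conv_eq_average_rightTranslate])
  filter_upwards [hinv C hC δ hδ] with γ h s hs using h s hs (t γ)

/-- The density functions of the sets `F_γ` are asymptotically left invariant, uniformly on compact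
sets, along every ultrafilter that contains the tails. -/
theorem eventually_norm_leftTranslateₗᵢ_lam_sub_le (𝒦 : Set (Compacts G))
    (h𝒦_union : ∀ K ∈ 𝒦, ∀ L ∈ 𝒦, K ⊔ L ∈ 𝒦)
    (h𝒦_cover : (⋃ K ∈ 𝒦, interior (K : Set G)) = Set.univ)
    (F : 𝒦 × ℕ+ → Compacts G)
    (hF : ∀ γ : 𝒦 × ℕ+, IsLeftInvariant μ ((γ.1 : Compacts G) : Set G) (1 / (γ.2 : ℝ)) (F γ))
    (p : Ultrafilter (𝒦 × ℕ+)) (hp : p ∈ tailUltrafilters (𝒦 × ℕ+)) (C : Set G) (hC : IsCompact C)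
    (δ : ℝ) (hδ : 0 < δ) :
    ∀ᶠ γ in p, ∀ s ∈ C, ‖leftTranslateₗᵢ μ s (lam μ (F γ)) - lam μ (F γ)‖ ≤ δ := by
  have hcov (x : G) : ∃ K ∈ 𝒦, x ∈ interior (K : Set G) := by
    simpa using h𝒦_cover.ge (Set.mem_univ x)
  -- Finitely many interiors cover `C`, and closure under unions merges them into one member of the
  -- family.
  obtain ⟨K, hK, hCK⟩ : ∃ K ∈ 𝒦, C ⊆ (K : Set G) := by
    refine hC.induction_on (p := fun C => ∃ K ∈ 𝒦, C ⊆ (K : Set G)) ?_ ?_ ?_ ?_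
    · obtain ⟨K, hK, -⟩ := hcov 1
      exact ⟨K, hK, Set.empty_subset _⟩
    · rintro s t hst ⟨K, hK, htK⟩
      exact ⟨K, hK, hst.trans htK⟩
    · rintro s t ⟨K, hK, hsK⟩ ⟨L, hL, htL⟩
      refine ⟨K ⊔ L, h𝒦_union K hK L hL, ?_⟩
      rw [Compacts.coe_sup]
      exact Set.union_subset_union hsK htL
    · intro x _
      obtain ⟨K, hK, hx⟩ := hcov x
      exact ⟨K, mem_nhdsWithin_of_mem_nhds (mem_interior_iff_mem_nhds.1 hx), K, hK, le_rfl⟩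
  obtain ⟨n, hn⟩ := exists_nat_one_div_lt hδ
  -- The tail starts at `n + 1`, matching the bound `1 / (n + 1) < δ`.
  filter_upwards [hp (⟨K, hK⟩, n.succPNat)] with γ hγ s hs
  have hγ' := (Set.mem_Ioi.1 hγ).le
  refine ((hF γ).2 s (hγ'.1 (hCK hs))).le.trans (le_trans ?_ hn.le)
  have h2 : ((n : ℝ) + 1) ≤ (γ.2 : ℝ) := by
    have : (n.succPNat : ℕ) ≤ (γ.2 : ℕ) := hγ'.2
    rw [Nat.succPNat_coe] at this
    exact_mod_cast this
  exact one_div_le_one_div_of_le (by positivity) h2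

end Invariance

end TopInvMean

end

/-! ### The three equalities -/

theorem mainTheorem9 {G : Type*} [Group G] [TopologicalSpace G] [IsTopologicalGroup G] [T2Space G]
    [LocallyCompactSpace G] [MeasurableSpace G] [BorelSpace G]
    (μ : Measure G) [μ.IsHaarMeasure] [μ.InnerRegular]
    (𝒦 : Set (Compacts G))
    (h𝒦_union : ∀ K ∈ 𝒦, ∀ L ∈ 𝒦, K ⊔ L ∈ 𝒦)
    (h𝒦_cover : (⋃ K ∈ 𝒦, interior (K : Set G)) = Set.univ)
    (F : 𝒦 × ℕ+ → Compacts G)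
    (hF : ∀ γ : 𝒦 × ℕ+,
      TopInvMean.IsLeftInvariant μ ((γ.1 : Compacts G) : Set G) (1 / (γ.2 : ℝ)) (F γ))
    (p : Ultrafilter (𝒦 × ℕ+)) (hp : p ∈ TopInvMean.tailUltrafilters (𝒦 × ℕ+)) :
    closure (convexHull ℝ (TopInvMean.limitSet p fun γ (t : G) =>
      TopInvMean.toDual μ (TopInvMean.rightTranslate μ t (TopInvMean.lam μ (F γ)))))
        = TopInvMean.TLIM μ ∧
    closure (convexHull ℝ (TopInvMean.limitSet p fun γ (t : G) =>
      TopInvMean.toDual μ (TopInvMean.leftTranslate μ t (TopInvMean.rho μ (F γ)))))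
        = TopInvMean.TRIM μ ∧
    closure (convexHull ℝ (TopInvMean.limitSet p fun γ (t : G) =>
      TopInvMean.toDual μ (TopInvMean.conv μ (TopInvMean.lam μ (F γ))
        (TopInvMean.leftTranslate μ t (TopInvMean.rho μ (F γ))))))
        = TopInvMean.TIM μ := by
  open TopInvMean in
  have hlam (γ : 𝒦 × ℕ+) : lam μ (F γ) ∈ P1 μ := lam_mem_P1 μ (hF γ).1
  have hrho (γ : 𝒦 × ℕ+) : rho μ (F γ) ∈ P1 μ := by
    rw [rho_eq]
    exact daggerₗᵢ_mem_P1 μ (hlam γ)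
  have hlaminv := eventually_norm_leftTranslateₗᵢ_lam_sub_le μ 𝒦 h𝒦_union h𝒦_cover F hF p hp
  have hrhoinv (C : Set G) (hC : IsCompact C) (δ : ℝ) (hδ : 0 < δ) :
      ∀ᶠ γ in p, ∀ s ∈ C, ‖rightTranslateₗᵢ μ s (rho μ (F γ)) - rho μ (F γ)‖ ≤ δ := by
    filter_upwards [hlaminv C hC δ hδ] with γ hγ s hs
    rw [rho_eq, norm_rightTranslateₗᵢ_dagger_sub]
    exact hγ s hs
  have hlr (γ : 𝒦 × ℕ+) (t : G) : leftTranslateₗᵢ μ t (rho μ (F γ)) ∈ P1 μ :=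
    leftTranslateₗᵢ_mem_P1 μ (hrho γ) t
  have hconv (γ : 𝒦 × ℕ+) (t : G) :
      ‖conv μ (lam μ (F γ)) (leftTranslateₗᵢ μ t (rho μ (F γ)))‖ ≤ 1 := by
    refine (norm_conv_le μ _ _).trans ?_
    rw [(hlam γ).2, (hlr γ t).2, one_mul]
  simp only [← rightTranslateₗᵢ_apply, ← leftTranslateₗᵢ_apply]
  refine ⟨subset_antisymm ?_ fun m hm => ?_, subset_antisymm ?_ fun m hm => ?_,
    subset_antisymm ?_ fun m hm => ?_⟩
  · refine closure_minimal (convexHull_min ?_ (convex_TLIM μ)) (isClosed_TLIM μ)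
    refine limitSet_subset_TLIM μ p
      (fun γ t => (rightTranslateₗᵢ_mem_P1 μ (hlam γ) t).2.le)
      (fun γ t => toDual_mem_means μ (rightTranslateₗᵢ_mem_P1 μ (hlam γ) t)) fun C hC δ hδ => ?_
    filter_upwards [hlaminv C hC δ hδ] with γ hγ s hs t
    -- The isometry `R_t` factors out of the difference, so the bound is uniform in `t`.
    rw [← rightTranslateₗᵢ_leftTranslateₗᵢ, ← map_sub, LinearIsometry.norm_map]
    exact hγ s hs
  · refine mem_closure_convexHull_limitSet p _ _ (fun γ t => norm_toDual_le μ _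
      (rightTranslateₗᵢ_mem_P1 μ (hlam γ) t).2.le) m fun T u γ h => ?_
    -- Invariance replaces `T` by `λ_γ T`, whose values are the pairings bounded in `h`.
    rw [← hm.2 _ (hlam γ) T _ (isLeftAct_orbitCoefficient μ _ T)]
    refine re_le_of_mem_means hm.1 ?_
    filter_upwards [coeFn_orbitCoefficient μ _ (continuous_rightTranslateₗᵢ μ) (lam μ (F γ)) T]
      with t ht
    rw [ht]
    exact h t
  · refine closure_minimal (convexHull_min ?_ (convex_TRIM μ)) (isClosed_TRIM μ)
    refine limitSet_subset_TRIM μ p (fun γ t => (hlr γ t).2.le)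
      (fun γ t => toDual_mem_means μ (hlr γ t)) fun C hC δ hδ => ?_
    filter_upwards [hrhoinv C hC δ hδ] with γ hγ s hs t
    rw [rightTranslateₗᵢ_leftTranslateₗᵢ, ← map_sub, LinearIsometry.norm_map]
    exact hγ s hs
  · refine mem_closure_convexHull_limitSet p _ _ (fun γ t => norm_toDual_le μ _
      (hlr γ t).2.le) m fun T u γ h => ?_
    rw [← hm.2 _ (hrho γ) T _ (isRightAct_orbitCoefficient μ _ T)]
    refine re_le_of_mem_means hm.1 ?_
    filter_upwards [coeFn_orbitCoefficient μ _ (continuous_leftTranslateₗᵢ μ) (rho μ (F γ)) T]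
      with t ht
    rw [ht]
    exact h t
  · refine closure_minimal (convexHull_min (Set.subset_inter ?_ ?_)
      ((convex_TLIM μ).inter (convex_TRIM μ))) ((isClosed_TLIM μ).inter (isClosed_TRIM μ))
    · refine limitSet_subset_TLIM μ p hconv
        (fun γ t => toDual_conv_mem_means μ (hlam γ) (hlr γ t)) fun C hC δ hδ => ?_
      filter_upwards [hlaminv C hC δ hδ] with γ hγ s hs t
      rw [leftTranslateₗᵢ_conv, conv_eq_average, conv_eq_average, ← _root_.sub_apply,
        ← map_sub]
      refine (norm_average_apply_le μ _ _ _ _).trans ?_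
      rw [(hlr γ t).2, mul_one]
      exact hγ s hs
    · refine limitSet_subset_TRIM μ p hconv
        (fun γ t => toDual_conv_mem_means μ (hlam γ) (hlr γ t)) fun C hC δ hδ => ?_
      filter_upwards [hrhoinv C hC δ hδ] with γ hγ s hs t
      rw [rightTranslateₗᵢ_conv, conv_eq_average, conv_eq_average, ← map_sub]
      refine (norm_average_apply_le μ _ _ _ _).trans ?_
      rw [(hlam γ).2, one_mul, rightTranslateₗᵢ_leftTranslateₗᵢ, ← map_sub,
        LinearIsometry.norm_map]
      exact hγ s hs
  · refine mem_closure_convexHull_limitSet p _ _ (fun γ t => norm_toDual_le μ _ (hconv γ t)) m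
      fun T u γ h => ?_
    -- Left invariance replaces `T` by `λ_γ T` and right invariance replaces that by `(λ_γ T) ρ_γ`,
    -- whose value at `t` is `⟨l_t ρ_γ, λ_γ T⟩ = ⟨λ_γ * l_t ρ_γ, T⟩`.
    rw [← hm.1.2 _ (hlam γ) T _ (isLeftAct_orbitCoefficient μ _ T),
      ← hm.2.2 _ (hrho γ) _ _ (isRightAct_orbitCoefficient μ _ _)]
    refine re_le_of_mem_means hm.1.1 ?_
    filter_upwards [coeFn_orbitCoefficient μ _ (continuous_leftTranslateₗᵢ μ) (rho μ (F γ))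
      (orbitCoefficient μ _ (continuous_rightTranslateₗᵢ μ) (lam μ (F γ)) T)] with t ht
    rw [ht, isLeftAct_orbitCoefficient]
    exact h t
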